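/- **Theorem (Tractability of antisymmetric problems, absolute error).** Let $H_1, G_1$ be real Hilbert spaces, let $S_1\colon H_1\to G_1$ be a compact linear operator, and let $\lambda=(\lambda_m)_{m\in\mathbb N}$ be the non-increasing sequence of the eigenvalues of $W_1=S_1^\dagger S_1$, each positive eigenvalue being listed according to its multiplicity (filled up with zeros if there are only finitely many positive ones). For $d\in\mathbb N=\{1,2,\dots\}$ let $H_d=H_1\otimes\dots\otimes H_1$ and $G_d=G_1\otimes\dots\otimes G_1$ be the $d$-fold Hilbert space tensor products (completions of the span of the simple tensors with respect to $\langle\bigotimes_l f_l,\bigotimes_l g_l\rangle=\prod_l\langle f_l,g_l\rangle$). For every $d$ let $I_d\subset\{1,\dots,d\}$, with $I_d\neq\emptyset$ for $d>1$, and let $\mathcal S_{I_d}$ be the group of permutations of $\{1,\dots,d\}$ fixing the complement of $I_d$. The antisymmetrizer $\mathfrak A_{I_d}\colon H_d\to H_d$ is the continuous linear map with $$\mathfrak A_{I_d}(f_1\otimes\dots\otimes f_d)=\frac1{\#\mathcal S_{I_d}}\sum_{\pi\in\mathcal S_{I_d}}\operatorname{sgn}(\pi)\, f_{\pi(1)}\otimes\dots\otimes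 f_{\pi(d)} ,$$ and $S_d\colon\mathfrak A_{I_d}(H_d)\to G_d$ denotes the restriction of the tensor product operator $S_1\otimes\dots\otimes S_1$ to the range of $\mathfrak A_{I_d}$, the space of $I_d$-antisymmetric elements. (For $d=1$ there is no antisymmetry condition.) For $n\in\mathbb N_0$ let $e(n,d)$ be the infimum of the worst case errors $\sup\{\|A f-S_d f\| : f\in\mathfrak A_{I_d}(H_d),\ \|f\|\le 1\}$ over all algorithms $A f=\phi(y_1,\dots,y_n)$ that use $n$ adaptively chosen continuous linear functionals, i.e. $y_k=L_k(f;y_1,\dots,y_{k-1})$ with $L_k(\,\cdot\,;y_1,\dots,y_{k-1})$ linear and continuous and $\phi\colon\mathbb R^n\to G_d$ arbitrary. Let $n(\varepsilon,d)=\min\{n\in\mathbb N_0: e(n,d)\le\varepsilon\}$ be the information complexity for the absolute error criterion. The problem $\{S_d\}$ is *polynomially tractable* if there are $C,p>0$ and $q\ge0$ with $n(\varepsilon,d)\le C\,\varepsilon^{-p}d^{\,q}$ for all $d\in\mathbb N$ and $\varepsilon\in(0,1]$; it is *strongly polynomially tractable* if this holds with $q=0$. If $\lambda_1<1$, then the following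 statements are equivalent: 1. $\{S_d\}$ is strongly polynomially tractable. 2. $\{S_d\}$ is polynomially tractable. 3. There is a $\tau\in(0,\infty)$ with $\lambda\in\ell_\tau$. The same three statements are also equivalent if $\lambda_1\ge1$ and $\#I_d$ grows linearly with $d$, i.e. there are $c>0$ and $d_0\in\mathbb N$ with $\#I_d\ge c\,d$ for all $d\ge d_0$. -/

import Mathlib

open scoped TensorProduct ENNReal

noncomputable section

/-! ## Hilbert tensor powers -/

section AlgebraicTensorPower

/-- The algebraic `d`-fold tensor power of a real vector space `H`, i.e. all finite linear
combinations of simple tensors `f₁ ⊗ ⋯ ⊗ f_d`.  (A type synonym, so that it carries the norm of the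
cross inner product below and not the projective seminorm.) -/
def AlgTensor (d : ℕ) (H : Type*) [AddCommGroup H] [Module ℝ H] : Type _ :=
  ⨂[ℝ] _ : Fin d, H

instance (d : ℕ) (H : Type*) [AddCommGroup H] [Module ℝ H] : AddCommGroup (AlgTensor d H) :=
  inferInstanceAs (AddCommGroup (⨂[ℝ] _ : Fin d, H))

instance (d : ℕ) (H : Type*) [AddCommGroup H] [Module ℝ H] : Module ℝ (AlgTensor d H) :=
  inferInstanceAs (Module ℝ (⨂[ℝ] _ : Fin d, H))

namespace AlgTensor

variable {d : ℕ} {H G : Type*} [AddCommGroup H] [Module ℝ H] [AddCommGroup G] [Module ℝ G]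

/-- The simple tensor `f₁ ⊗ ⋯ ⊗ f_d`, as a multilinear map of the family `f`. -/
def pure : MultilinearMap ℝ (fun _ : Fin d => H) (AlgTensor d H) :=
  PiTensorProduct.tprod ℝ

/-- The linear map on the algebraic tensor power induced by a multilinear map. -/
def lift (m : MultilinearMap ℝ (fun _ : Fin d => H) G) : AlgTensor d H →ₗ[ℝ] G :=
  PiTensorProduct.lift m

theorem lift_pure (m : MultilinearMap ℝ (fun _ : Fin d => H) G) (f : Fin d → H) :
    lift m (pure f) = m f :=
  PiTensorProduct.lift.tprod f

theorem hom_ext {A B : AlgTensor d H →ₗ[ℝ] G} (h : ∀ f, A (pure f) = B (pure f)) : A = B :=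
  PiTensorProduct.ext (MultilinearMap.ext h)

theorem exists_eq_sum (t : AlgTensor d H) : ∃ (n : ℕ) (c : Fin n → ℝ) (f : Fin n → Fin d → H),
    t = ∑ i, c i • pure (f i) := by
  have ht : ∀ u : ⨂[ℝ] _ : Fin d, H,
      u ∈ Submodule.span ℝ (Set.range (PiTensorProduct.tprod ℝ (s := fun _ : Fin d => H))) := by
    intro u
    rw [PiTensorProduct.span_tprod_eq_top]
    exact Submodule.mem_top
  obtain ⟨n, c, g, hg⟩ := Submodule.mem_span_set'.1 (ht t)
  choose f hf using fun i => (g i).2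
  refine ⟨n, c, f, ?_⟩
  refine hg.symm.trans (Finset.sum_congr rfl fun i _ => ?_)
  rw [← hf i]
  rfl

/-- The bilinear form on the tensor power with
`(⨂ fₗ, ⨂ gₗ) ↦ ∏ₗ A fₗ gₗ`. -/
def form (d : ℕ) (A : H →ₗ[ℝ] H →ₗ[ℝ] ℝ) : AlgTensor d H →ₗ[ℝ] AlgTensor d H →ₗ[ℝ] ℝ :=
  (PiTensorProduct.map₂ (fun _ : Fin d => A)).compr₂
    (PiTensorProduct.lift (MultilinearMap.mkPiAlgebra ℝ (Fin d) ℝ))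

theorem form_pure (A : H →ₗ[ℝ] H →ₗ[ℝ] ℝ) (f g : Fin d → H) :
    form d A (pure f) (pure g) = ∏ l, A (f l) (g l) := by
  have h : PiTensorProduct.lift (MultilinearMap.mkPiAlgebra ℝ (Fin d) ℝ)
      (PiTensorProduct.map₂ (fun _ : Fin d => A) (PiTensorProduct.tprod ℝ f)
        (PiTensorProduct.tprod ℝ g)) = ∏ l, A (f l) (g l) := by
    rw [PiTensorProduct.map₂_tprod_tprod, PiTensorProduct.lift.tprod,
      MultilinearMap.mkPiAlgebra_apply]
  exact h

theorem form_symm (A : H →ₗ[ℝ] H →ₗ[ℝ] ℝ) (hA : ∀ x y, A x y = A y x) (s t : AlgTensor d H) :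
    form d A s t = form d A t s := by
  have : form d A = (form d A).flip := by
    refine hom_ext fun f => hom_ext fun g => ?_
    rw [LinearMap.flip_apply, form_pure, form_pure]
    exact Finset.prod_congr rfl fun l _ => hA _ _
  exact congrArg (fun F => F s t) this

theorem gram_posSemidef (A : H →ₗ[ℝ] H →ₗ[ℝ] ℝ) (hA : ∀ x y, A x y = A y x)
    (hA' : ∀ x, 0 ≤ A x x) {n : ℕ} (f : Fin n → H) :
    (Matrix.of fun i j => A (f i) (f j)).PosSemidef := by
  refine Matrix.PosSemidef.of_dotProduct_mulVec_nonneg ?_ fun c => ?_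
  · ext i j
    simp [hA]
  · have h := hA' (∑ i, c i • f i)
    simp only [map_sum, map_smul, LinearMap.sum_apply, LinearMap.smul_apply, smul_eq_mul,
      Finset.mul_sum] at h
    rw [Finset.sum_comm] at h
    simp only [dotProduct, Matrix.mulVec, Matrix.of_apply, star_trivial, Finset.mul_sum]
    refine h.trans_eq (Finset.sum_congr rfl fun i _ => Finset.sum_congr rfl fun j _ => by ring)

/-- If `0 ≤ A ≤ B` as quadratic forms, then the same holds for the induced forms on the tensor
power (a consequence of the Schur product theorem). -/
theorem form_mono (A B : H →ₗ[ℝ] H →ₗ[ℝ] ℝ) (hA : ∀ x y, A x y = A y x)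
    (hB : ∀ x y, B x y = B y x) (hA' : ∀ x, 0 ≤ A x x) (hAB : ∀ x, A x x ≤ B x x)
    (t : AlgTensor d H) : 0 ≤ form d A t t ∧ form d A t t ≤ form d B t t := by
  obtain ⟨n, c, f, rfl⟩ := exists_eq_sum t
  have hexp : ∀ F : H →ₗ[ℝ] H →ₗ[ℝ] ℝ,
      form d F (∑ i, c i • pure (f i)) (∑ i, c i • pure (f i))
        = star c ⬝ᵥ ((Matrix.of fun i j => ∏ l, F (f i l) (f j l)).mulVec c) := by
    intro F
    simp only [map_sum, map_smul, LinearMap.sum_apply, LinearMap.smul_apply, smul_eq_mul,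
      form_pure, Finset.mul_sum]
    rw [Finset.sum_comm]
    simp only [dotProduct, Matrix.mulVec, Matrix.of_apply, star_trivial, Finset.mul_sum]
    exact Finset.sum_congr rfl fun i _ => Finset.sum_congr rfl fun j _ => by ring
  have key : ∀ s : Finset (Fin d),
      (Matrix.of fun i j => ∏ l ∈ s, A (f i l) (f j l)).PosSemidef ∧
      (Matrix.of fun i j => ∏ l ∈ s, B (f i l) (f j l)
        - ∏ l ∈ s, A (f i l) (f j l)).PosSemidef := by
    intro s
    induction s using Finset.induction_on with
    | empty =>
      constructor
      · refine Matrix.PosSemidef.of_dotProduct_mulVec_nonneg ?_ fun c => ?_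
        · ext i j
          simp
        · simp only [Finset.prod_empty, star_trivial, dotProduct, Matrix.mulVec, Matrix.of_apply,
            one_mul, ← Finset.sum_mul]
          exact mul_self_nonneg _
      · have : (Matrix.of fun i j : Fin n => ∏ l ∈ (∅ : Finset (Fin d)), B (f i l) (f j l)
            - ∏ l ∈ (∅ : Finset (Fin d)), A (f i l) (f j l)) = 0 := by
          ext i j
          simp
        rw [this]
        exact Matrix.PosSemidef.zero
    | insert a s ha ih =>
      have hAa := gram_posSemidef A hA hA' (fun i => f i a)
      have hBa := gram_posSemidef B hB (fun x => (hA' x).trans (hAB x)) (fun i => f i a)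
      have hDa := gram_posSemidef (B - A) (fun x y => by simp [hA x y, hB x y])
        (fun x => by simpa using hAB x) (fun i => f i a)
      constructor
      · have e : (Matrix.of fun i j => ∏ l ∈ insert a s, A (f i l) (f j l))
            = Matrix.hadamard (Matrix.of fun i j => A (f i a) (f j a))
              (Matrix.of fun i j => ∏ l ∈ s, A (f i l) (f j l)) := by
          ext i j
          simp [Finset.prod_insert ha, Matrix.hadamard_apply]
        rw [e]
        exact hAa.hadamard ih.1
      · have e : (Matrix.of fun i j => ∏ l ∈ insert a s, B (f i l) (f j l)
              - ∏ l ∈ insert a s, A (f i l) (f j l))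
            = Matrix.hadamard (Matrix.of fun i j => B (f i a) (f j a))
                (Matrix.of fun i j => ∏ l ∈ s, B (f i l) (f j l) - ∏ l ∈ s, A (f i l) (f j l))
              + Matrix.hadamard (Matrix.of fun i j => (B - A) (f i a) (f j a))
                (Matrix.of fun i j => ∏ l ∈ s, A (f i l) (f j l)) := by
          ext i j
          simp only [Finset.prod_insert ha, Matrix.hadamard_apply, Matrix.of_apply,
            Matrix.add_apply, LinearMap.sub_apply]
          ring
        rw [e]
        exact (hBa.hadamard ih.2).add (hDa.hadamard ih.1)
  have h1 := (key Finset.univ).1.dotProduct_mulVec_nonneg c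
  have h2 := (key Finset.univ).2.dotProduct_mulVec_nonneg c
  refine ⟨by rw [hexp]; exact h1, ?_⟩
  rw [hexp, hexp, ← sub_nonneg, ← dotProduct_sub, ← Matrix.sub_mulVec]
  exact h2

end AlgTensor

end AlgebraicTensorPower

section HilbertTensorPower

variable {d : ℕ} {H G : Type*} [NormedAddCommGroup H] [InnerProductSpace ℝ H]
  [NormedAddCommGroup G] [InnerProductSpace ℝ G]

/-- The cross inner product `⟪⨂ fₗ, ⨂ gₗ⟫ = ∏ₗ ⟪fₗ, gₗ⟫` on the algebraic tensor power. -/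
@[reducible] def AlgTensor.core (d : ℕ) (H : Type*) [NormedAddCommGroup H]
    [InnerProductSpace ℝ H] : PreInnerProductSpace.Core ℝ (AlgTensor d H) where
  inner s t := AlgTensor.form d (innerₗ H) s t
  conj_inner_symm s t := AlgTensor.form_symm _ (fun x y => real_inner_comm y x) t s
  re_inner_nonneg t := (AlgTensor.form_mono (innerₗ H) (innerₗ H)
    (fun x y => real_inner_comm y x) (fun x y => real_inner_comm y x)
    (fun _ => real_inner_self_nonneg) (fun _ => le_rfl) t).1
  add_left s t u := by rw [map_add]; rfl
  smul_left s t r := by rw [map_smul]; rfl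

instance (d : ℕ) (H : Type*) [NormedAddCommGroup H] [InnerProductSpace ℝ H] :
    SeminormedAddCommGroup (AlgTensor d H) :=
  @InnerProductSpace.Core.toSeminormedAddCommGroup ℝ _ _ _ _ (AlgTensor.core d H)

instance (d : ℕ) (H : Type*) [NormedAddCommGroup H] [InnerProductSpace ℝ H] :
    InnerProductSpace ℝ (AlgTensor d H) :=
  InnerProductSpace.ofCore (AlgTensor.core d H)

/-- The `d`-fold Hilbert space tensor power `H ⊗ ⋯ ⊗ H`: the completion of the span of the simple
tensors with respect to the cross inner product. -/
abbrev HilbertTensor (d : ℕ) (H : Type*) [NormedAddCommGroup H] [InnerProductSpace ℝ H] : Type _ :=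
  UniformSpace.Completion (AlgTensor d H)

namespace HilbertTensor

/-- The simple tensor `f₁ ⊗ ⋯ ⊗ f_d` in the Hilbert tensor power. -/
def pure (f : Fin d → H) : HilbertTensor d H := ((AlgTensor.pure f : AlgTensor d H) : HilbertTensor d H)

theorem algInner_eq (s t : AlgTensor d H) : inner ℝ s t = AlgTensor.form d (innerₗ H) s t := rfl

theorem inner_pure (f g : Fin d → H) : inner ℝ (pure f) (pure g) = ∏ l, inner ℝ (f l) (g l) := by
  rw [pure, pure, UniformSpace.Completion.inner_coe, algInner_eq, AlgTensor.form_pure]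
  rfl

/-- The continuous extension to the Hilbert tensor powers of a bounded linear map between the
algebraic tensor powers. -/
def extend {e : ℕ} (A : AlgTensor d H →L[ℝ] AlgTensor e G) :
    HilbertTensor d H →L[ℝ] HilbertTensor e G :=
  ((UniformSpace.Completion.toComplL (𝕜 := ℝ) (E := AlgTensor e G)).comp A).extend
    (UniformSpace.Completion.toComplL (𝕜 := ℝ) (E := AlgTensor d H))

theorem extend_coe {e : ℕ} (A : AlgTensor d H →L[ℝ] AlgTensor e G) (t : AlgTensor d H) :
    extend A (t : HilbertTensor d H) = (A t : HilbertTensor e G) :=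
  ContinuousLinearMap.extend_eq _ UniformSpace.Completion.denseRange_coe
    (UniformSpace.Completion.isUniformInducing_coe _) t

/-- The tensor power of `S` on the algebraic tensor power. -/
def algMap (d : ℕ) (S : H →L[ℝ] G) : AlgTensor d H →ₗ[ℝ] AlgTensor d G :=
  AlgTensor.lift (AlgTensor.pure.compLinearMap fun _ => S.toLinearMap)

theorem norm_algMap_le (S : H →L[ℝ] G) (t : AlgTensor d H) :
    ‖algMap d S t‖ ≤ ‖S‖ ^ d * ‖t‖ := by
  set A : H →ₗ[ℝ] H →ₗ[ℝ] ℝ := (innerₗ G).compl₁₂ S.toLinearMap S.toLinearMap with hA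
  set B : H →ₗ[ℝ] H →ₗ[ℝ] ℝ := (‖S‖ ^ 2) • innerₗ H with hB
  have e1 : AlgTensor.form d A
      = (AlgTensor.form d (innerₗ G)).compl₁₂ (algMap d S) (algMap d S) := by
    refine AlgTensor.hom_ext fun f => AlgTensor.hom_ext fun g => ?_
    rw [LinearMap.compl₁₂_apply, algMap, AlgTensor.lift_pure, AlgTensor.lift_pure,
      AlgTensor.form_pure, MultilinearMap.compLinearMap_apply, MultilinearMap.compLinearMap_apply,
      AlgTensor.form_pure]
    rfl
  have e2 : AlgTensor.form d B = ((‖S‖ ^ d) ^ 2) • AlgTensor.form d (innerₗ H) := by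
    refine AlgTensor.hom_ext fun f => AlgTensor.hom_ext fun g => ?_
    rw [LinearMap.smul_apply, LinearMap.smul_apply, AlgTensor.form_pure, AlgTensor.form_pure]
    simp [hB, Finset.prod_mul_distrib, ← pow_mul, mul_comm]
  have h := (AlgTensor.form_mono A B (fun x y => real_inner_comm _ _)
    (fun x y => by simp [hB, real_inner_comm]) (fun x => real_inner_self_nonneg)
    (fun x => by
      have := pow_le_pow_left₀ (norm_nonneg _) (S.le_opNorm x) 2
      simpa [hA, hB, mul_pow] using this) t).2
  rw [e1, e2, LinearMap.compl₁₂_apply, LinearMap.smul_apply, LinearMap.smul_apply,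
    ← algInner_eq, ← algInner_eq, real_inner_self_eq_norm_sq, real_inner_self_eq_norm_sq,
    smul_eq_mul, ← mul_pow] at h
  exact le_of_sq_le_sq h (by positivity)

/-- The tensor product operator `S ⊗ ⋯ ⊗ S` (`d` factors): the continuous linear extension of
`f₁ ⊗ ⋯ ⊗ f_d ↦ S f₁ ⊗ ⋯ ⊗ S f_d`. -/
def map (d : ℕ) (S : H →L[ℝ] G) : HilbertTensor d H →L[ℝ] HilbertTensor d G :=
  extend ((algMap d S).mkContinuous (‖S‖ ^ d) (norm_algMap_le S))

theorem map_pure (S : H →L[ℝ] G) (f : Fin d → H) :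
    map d S (pure f) = pure fun l => S (f l) := by
  rw [map, pure, extend_coe, LinearMap.mkContinuous_apply, algMap, AlgTensor.lift_pure]
  rfl

/-- Permutation of the tensor factors on the algebraic tensor power. -/
def algPerm (H : Type*) [NormedAddCommGroup H] [InnerProductSpace ℝ H] (π : Equiv.Perm (Fin d)) :
    AlgTensor d H →ₗ[ℝ] AlgTensor d H :=
  AlgTensor.lift (AlgTensor.pure.domDomCongr π)

theorem norm_algPerm_le (π : Equiv.Perm (Fin d)) (t : AlgTensor d H) :
    ‖algPerm H π t‖ ≤ 1 * ‖t‖ := by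
  have e : AlgTensor.form d (innerₗ H)
      = (AlgTensor.form d (innerₗ H)).compl₁₂ (algPerm H π) (algPerm H π) := by
    refine AlgTensor.hom_ext fun f => AlgTensor.hom_ext fun g => ?_
    rw [LinearMap.compl₁₂_apply, algPerm, AlgTensor.lift_pure, AlgTensor.lift_pure,
      AlgTensor.form_pure, MultilinearMap.domDomCongr_apply, MultilinearMap.domDomCongr_apply,
      AlgTensor.form_pure]
    exact (Equiv.prod_comp π fun l => innerₗ H (f l) (g l)).symm
  have h := congrArg (fun F => F t t) e
  simp only [LinearMap.compl₁₂_apply] at h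
  rw [← algInner_eq, ← algInner_eq, real_inner_self_eq_norm_sq, real_inner_self_eq_norm_sq] at h
  rw [one_mul]
  exact le_of_sq_le_sq h.ge (norm_nonneg _)

/-- Permutation of the tensor factors:
`f₁ ⊗ ⋯ ⊗ f_d ↦ f_{π(1)} ⊗ ⋯ ⊗ f_{π(d)}`. -/
def perm (H : Type*) [NormedAddCommGroup H] [InnerProductSpace ℝ H] (π : Equiv.Perm (Fin d)) :
    HilbertTensor d H →L[ℝ] HilbertTensor d H :=
  extend ((algPerm H π).mkContinuous 1 (norm_algPerm_le π))

theorem perm_pure (π : Equiv.Perm (Fin d)) (f : Fin d → H) :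
    perm H π (pure f) = pure fun l => f (π l) := by
  rw [perm, pure, extend_coe, LinearMap.mkContinuous_apply, algPerm, AlgTensor.lift_pure]
  rfl

end HilbertTensor

/-! ## Antisymmetric subspaces -/

/-- All permutations of the `d` coordinates that leave the complement of `I` fixed. -/
def permsFixingCompl {d : ℕ} (I : Finset (Fin d)) : Finset (Equiv.Perm (Fin d)) :=
  Finset.univ.filter fun π => ∀ i, i ∉ I → π i = i

/-- The antisymmetrizer with respect to the coordinates in `I`: the average of
`sign π • perm π` over all permutations `π` that fix the complement of `I`. -/
def antisymmetrizer (H : Type*) [NormedAddCommGroup H] [InnerProductSpace ℝ H] {d : ℕ}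
    (I : Finset (Fin d)) : HilbertTensor d H →L[ℝ] HilbertTensor d H :=
  ((permsFixingCompl I).card : ℝ)⁻¹ •
    ∑ π ∈ permsFixingCompl I, ((Equiv.Perm.sign π : ℤ) : ℝ) • HilbertTensor.perm H π

/-- The subspace of `I`-antisymmetric elements: the range of the antisymmetrizer. -/
def antisymSubspace (H : Type*) [NormedAddCommGroup H] [InnerProductSpace ℝ H] {d : ℕ}
    (I : Finset (Fin d)) : Submodule ℝ (HilbertTensor d H) :=
  LinearMap.range (antisymmetrizer H I).toLinearMap

/-- The `I`-antisymmetric `d`-variate problem: the restriction of `S ⊗ ⋯ ⊗ S` to the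
`I`-antisymmetric subspace. -/
def antisymProblem (S : H →L[ℝ] G) {d : ℕ} (I : Finset (Fin d)) :
    antisymSubspace H I →L[ℝ] HilbertTensor d G :=
  (HilbertTensor.map d S).comp (antisymSubspace H I).subtypeL

end HilbertTensorPower

/-! ## Information complexity in the worst case setting, absolute error criterion -/

section Complexity

/-- The first `n` values `y₁ = L₁(f), y₂ = L₂(f; y₁), …, yₙ = Lₙ(f; y₁, …, yₙ₋₁)` of adaptive
linear information; each functional may depend on the values computed before. -/
def adaptiveInfo {F : Type*} [NormedAddCommGroup F] [NormedSpace ℝ F]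
    (L : ∀ k : ℕ, (Fin k → ℝ) → (F →L[ℝ] ℝ)) (f : F) : ∀ n : ℕ, Fin n → ℝ
  | 0 => Fin.elim0
  | n + 1 => Fin.snoc (adaptiveInfo L f n) (L n (adaptiveInfo L f n) f)

/-- An algorithm using `n` (adaptively chosen) continuous linear functionals, combined by an
arbitrary map `φ : ℝⁿ → G`.  Only the functionals `L 0, …, L (n - 1)` are used. -/
structure InfoAlgorithm (F G : Type*) [NormedAddCommGroup F] [NormedSpace ℝ F] (n : ℕ) where
  L : ∀ k : ℕ, (Fin k → ℝ) → (F →L[ℝ] ℝ)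
  φ : (Fin n → ℝ) → G

/-- The output of an algorithm on the input `f`. -/
def InfoAlgorithm.eval {F G : Type*} [NormedAddCommGroup F] [NormedSpace ℝ F] {n : ℕ}
    (A : InfoAlgorithm F G n) (f : F) : G :=
  A.φ (adaptiveInfo A.L f n)

variable {F G : Type*} [NormedAddCommGroup F] [NormedSpace ℝ F]
  [NormedAddCommGroup G] [NormedSpace ℝ G]

/-- Worst case error over the unit ball of `F` (possibly `∞`). -/
def worstCaseError (T : F →L[ℝ] G) {n : ℕ} (A : InfoAlgorithm F G n) : ℝ≥0∞ :=
  ⨆ f : F, ⨆ _ : ‖f‖ ≤ 1, ‖A.eval f - T f‖ₑ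

/-- The `n`-th minimal error. -/
def minimalError (T : F →L[ℝ] G) (n : ℕ) : ℝ≥0∞ :=
  ⨅ A : InfoAlgorithm F G n, worstCaseError T A

/-- The information complexity `min {n ∈ ℕ₀ | e(n) ≤ ε}` (`∞` if there is no such `n`). -/
def infoComplexity (T : F →L[ℝ] G) (ε : ℝ) : ℕ∞ :=
  ⨅ n : ℕ, ⨅ _ : minimalError T n ≤ ENNReal.ofReal ε, (n : ℕ∞)

/-- `n(ε, d) ≤ C ε⁻ᵖ d^q` for all `d ∈ {1, 2, …}` and `ε ∈ (0, 1]`. -/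
def TractabilityBound (n : ℝ → ℕ → ℕ∞) (C p q : ℝ) : Prop :=
  ∀ d : ℕ, 1 ≤ d → ∀ ε : ℝ, 0 < ε → ε ≤ 1 →
    (n ε d : ℝ≥0∞) ≤ ENNReal.ofReal (C * ε ^ (-p) * (d : ℝ) ^ q)

/-- Polynomial tractability of a problem with information complexity `n(ε, d)`. -/
def PolynomiallyTractable (n : ℝ → ℕ → ℕ∞) : Prop :=
  ∃ C p q : ℝ, 0 < C ∧ 0 < p ∧ 0 ≤ q ∧ TractabilityBound n C p q

/-- Strong polynomial tractability: the bound holds with `q = 0`. -/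
def StronglyPolynomiallyTractable (n : ℝ → ℕ → ℕ∞) : Prop :=
  ∃ C p : ℝ, 0 < C ∧ 0 < p ∧ TractabilityBound n C p 0

end Complexity

/-- `lam 0 ≥ lam 1 ≥ ⋯ ≥ 0` is the non-increasing sequence of the eigenvalues of the compact positive
operator `W`, where each positive eigenvalue is listed according to its multiplicity (and the
sequence is filled up with zeros if there are only finitely many positive eigenvalues). -/
def IsEigenvalueSequence {H : Type*} [NormedAddCommGroup H] [InnerProductSpace ℝ H]
    (W : H →L[ℝ] H) (lam : ℕ → ℝ) : Prop :=
  Antitone lam ∧ (∀ m, 0 ≤ lam m) ∧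
    ∀ t : ℝ, 0 < t → {m : ℕ | lam m = t}.encard =
      (Module.finrank ℝ (Module.End.eigenspace W.toLinearMap t) : ℕ∞)

/-- The number of elements of `I d ⊆ {1, …, d}` grows linearly with `d` (an upper linear bound is
automatic). -/
def CardGrowsLinearly (I : ∀ d : ℕ, Finset (Fin d)) : Prop :=
  ∃ c : ℝ, 0 < c ∧ ∃ d₀ : ℕ, ∀ d : ℕ, d₀ ≤ d → c * (d : ℝ) ≤ ((I d).card : ℝ)

end

/-! The tensor products of the eigenvectors of `S†S` diagonalize the tensor power, with products of
the `lam m` as eigenvalues. Antisymmetry in `I` has two effects on the coefficients of `f` in this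
basis: they vanish at index tuples not injective on `I`, and along an orbit of the permutations of
`I` they agree up to sign. One functional therefore serves `(#I)!` tuples. A Markov count of the
tuples whose product exceeds `ε ^ 2` shows that `ε ^ (-2τ) * Λ ^ d / (#I)!` functionals suffice,
where `Λ = ∑ lam m ^ τ` (`exists_infoComplexity_antisymProblem_le`).

It remains to bound `Λ ^ d / (#I)!` uniformly in `d`. If `lam 0 < 1`, a larger `τ` makes `Λ ≤ 1`
(`exists_tsum_rpow_le_one`). If `#I` grows linearly, the factorial beats the power
(`exists_pow_div_factorial_le`).

Conversely, `d = 1` alone forces summability. Adaptive information cannot beat a singular subspace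
of larger dimension (`le_minimalError`), so the complexity bound counts the eigenvalues above `ε ^
2` and gives polynomial decay (`summable_rpow_of_counting`). -/

/-- Two families of reals that take every positive value equally often (and finitely often):
the positive part of the first one embeds into the second one. -/
theorem exists_injective_of_encard_fiber_eq {α β : Type*} (a : α → ℝ) (b : β → ℝ)
    (h : ∀ t : ℝ, 0 < t → {i | a i = t}.encard = {j | b j = t}.encard)
    (hfin : ∀ t : ℝ, 0 < t → {i | a i = t}.Finite) :
    ∃ g : {i // 0 < a i} → β, Function.Injective g ∧ ∀ i, b (g i) = a i := by
  have h1 : ∀ t : ℝ, 0 < t → Nonempty ({i | a i = t} ≃ {j | b j = t}) := fun t ht => by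
    have f1 := (hfin t ht).fintype
    have f2 : {j | b j = t}.Finite := by
      rw [← Set.encard_lt_top_iff, ← h t ht, Set.encard_lt_top_iff]
      exact hfin t ht
    have f3 := f2.fintype
    have e := h t ht
    rw [Set.encard_eq_coe_toFinset_card, Set.encard_eq_coe_toFinset_card, Nat.cast_inj,
      Set.toFinset_card, Set.toFinset_card] at e
    exact ⟨Fintype.equivOfCardEq e⟩
  have e : ∀ t : {t : ℝ // 0 < t}, {i | a i = t} ≃ {j | b j = t} := fun t =>
    Classical.choice (h1 t t.2)
  have hg : ∀ i : {i // 0 < a i}, b (e ⟨a i, i.2⟩ ⟨i, rfl⟩ : β) = a i := fun i =>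
    (e ⟨a i, i.2⟩ ⟨i, rfl⟩).2
  refine ⟨fun i => e ⟨a i, i.2⟩ ⟨i, rfl⟩, ?_, hg⟩
  -- The bijections `e t` depend on the level `t`. With both levels as variables, `rfl` can identify
  -- them before injectivity of a single `e s` is used.
  have key : ∀ (s t : {t : ℝ // 0 < t}) (x : {i | a i = s}) (y : {i | a i = t}), s = t →
      ((e s x : {j | b j = s}) : β) = (e t y : {j | b j = t}) → (x : α) = y := by
    rintro s _ x y rfl hxy
    exact congrArg Subtype.val ((e s).injective (Subtype.ext hxy))
  intro i j hij
  have hij' : a i = a j := by rw [← hg i, ← hg j]; exact congrArg b hij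
  exact Subtype.ext (key ⟨a i, i.2⟩ ⟨a j, j.2⟩ ⟨i, rfl⟩ ⟨j, rfl⟩ (Subtype.ext hij') hij)

/-! ### Spectral theorem as a Hilbert basis with multiplicities. -/

section Spectral

universe u

variable {H : Type u} [NormedAddCommGroup H] [InnerProductSpace ℝ H] [CompleteSpace H]

/-- A compact symmetric operator has a Hilbert basis of eigenvectors, and every nonzero eigenvalue
is listed according to its finite multiplicity. -/
theorem exists_hilbertBasis_eigenvectors (W : H →L[ℝ] H) (hW : IsCompactOperator W)
    (hsymm : W.toLinearMap.IsSymmetric) :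
    ∃ (ι : Type u) (b : HilbertBasis ι ℝ H) (μ : ι → ℝ), (∀ i, W (b i) = μ i • b i) ∧
      ∀ t : ℝ, t ≠ 0 → {i | μ i = t}.Finite ∧ {i | μ i = t}.encard =
        (Module.finrank ℝ (Module.End.eigenspace W.toLinearMap t) : ℕ∞) := by
  set V : ℝ → Submodule ℝ H := fun t => Module.End.eigenspace W.toLinearMap t with hV
  have hclosed : ∀ t, IsClosed (V t : Set H) := fun t => by
    have : (V t : Set H) = {x | W x = t • x} := by
      ext x
      simp [hV]
    rw [this]
    exact isClosed_eq W.continuous (continuous_const_smul t)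
  have hcomplete : ∀ t, CompleteSpace (V t) := fun t => (hclosed t).completeSpace_coe
  -- All real `t` are allowed: a non-eigenvalue contributes an empty basis, and `t = 0` supplies a
  -- basis of the kernel.
  choose w B hB using fun t => exists_hilbertBasis ℝ (V t)
  have ho := hsymm.orthogonalFamily_eigenspaces.orthonormal_sigma_orthonormal
    (v_family := fun t => B t) (fun t => (B t).orthonormal)
  refine ⟨(Σ t, w t), HilbertBasis.mkOfOrthogonalEqBot ho ?_, fun i => i.1, ?_, ?_⟩
  -- The spectral theorem replaces `⊥` by the orthogonal complement of all eigenspaces.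
  -- Orthogonality to the chosen vectors passes to each eigenspace by density and continuity.
  · rw [← ContinuousLinearMap.orthogonalComplement_iSup_eigenspaces_eq_bot hW hsymm]
    refine le_antisymm ?_ (Submodule.orthogonal_le ?_)
    · intro x hx
      rw [Submodule.mem_orthogonal] at hx ⊢
      suffices h : ∀ t, V t ≤ (ℝ ∙ x)ᗮ by
        intro u hu
        have := (iSup_le h) hu
        rw [Submodule.mem_orthogonal_singleton_iff_inner_left] at this
        exact this
      intro t y hy
      rw [Submodule.mem_orthogonal_singleton_iff_inner_left]
      have hd := (B t).dense_span
      have hy' : (⟨y, hy⟩ : V t) ∈ (Submodule.span ℝ (Set.range (B t))).topologicalClosure := by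
        rw [hd]; trivial
      have hle : (Submodule.span ℝ (Set.range (B t))).topologicalClosure ≤
          (LinearMap.ker ((innerSL ℝ x).comp (V t).subtypeL).toLinearMap) := by
        refine Submodule.topologicalClosure_minimal _ (Submodule.span_le.2 ?_)
          (ContinuousLinearMap.isClosed_ker _)
        rintro _ ⟨i, rfl⟩
        have := hx _ (Submodule.subset_span ⟨⟨t, i⟩, rfl⟩)
        simpa [real_inner_comm] using this
      have := hle hy'
      simpa [real_inner_comm] using this
    · rw [Submodule.span_le]
      rintro _ ⟨i, rfl⟩
      exact Submodule.mem_iSup_of_mem i.1 (B i.1 i.2).2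
  · intro i
    rw [HilbertBasis.coe_mkOfOrthogonalEqBot]
    exact Module.End.mem_eigenspace_iff.1 (B i.1 i.2).2
  · intro t ht
    have hf : FiniteDimensional ℝ (V t) :=
      ContinuousLinearMap.finite_dimensional_eigenspace hW t ht
    have hli := (B t).orthonormal.linearIndependent
    have hwf : Finite (w t) := hli.finite
    have := Fintype.ofFinite (w t)
    have hr : {i : Σ t, w t | i.1 = t} = Set.range (Sigma.mk t) := by
      ext ⟨s, i⟩
      constructor
      · rintro ⟨rfl⟩
        exact ⟨i, rfl⟩
      · rintro ⟨j, hj⟩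
        exact (congrArg Sigma.fst hj).symm
    rw [hr]
    refine ⟨Set.finite_range _, ?_⟩
    rw [← Set.image_univ, sigma_mk_injective.encard_image, Set.encard_univ,
      ENat.card_eq_coe_fintype_card, Nat.cast_inj, 
      Module.finrank_eq_card_basis (B t).toOrthonormalBasis.toBasis]

end Spectral

/-! ### Product bases and diagonalization of the tensor power. -/

section TensorBasis

universe u

variable {d : ℕ} {H : Type u} [NormedAddCommGroup H] [InnerProductSpace ℝ H]
  {G : Type*} [NormedAddCommGroup G] [InnerProductSpace ℝ G]

namespace HilbertTensor

/-- The simple tensor as a multilinear map into the Hilbert tensor power. -/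
noncomputable def pureMultilinear (d : ℕ) (H : Type*) [NormedAddCommGroup H]
    [InnerProductSpace ℝ H] :
    MultilinearMap ℝ (fun _ : Fin d => H) (HilbertTensor d H) :=
  (UniformSpace.Completion.toComplL (𝕜 := ℝ) (E := AlgTensor d H)).toLinearMap.compMultilinearMap
    AlgTensor.pure

theorem pureMultilinear_apply (f : Fin d → H) : pureMultilinear d H f = pure f := rfl

theorem norm_pure (f : Fin d → H) : ‖(pure f : HilbertTensor d H)‖ = ∏ l, ‖f l‖ := by
  have h : ‖(pure f : HilbertTensor d H)‖ ^ 2 = (∏ l, ‖f l‖) ^ 2 := by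
    rw [← real_inner_self_eq_norm_sq, inner_pure, ← Finset.prod_pow]
    exact Finset.prod_congr rfl fun l _ => real_inner_self_eq_norm_sq _
  exact (pow_left_inj₀ (norm_nonneg _) (Finset.prod_nonneg fun _ _ => norm_nonneg _)
    two_ne_zero).1 h

theorem continuous_pure : Continuous (pure : (Fin d → H) → HilbertTensor d H) :=
  MultilinearMap.continuous_of_bound (pureMultilinear d H) 1 fun f => by
    rw [pureMultilinear_apply, norm_pure, one_mul]

theorem topologicalClosure_span_range_pure :
    (Submodule.span ℝ (Set.range (pure : (Fin d → H) → HilbertTensor d H))).topologicalClosure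
      = ⊤ := by
  rw [← Submodule.dense_iff_topologicalClosure_eq_top]
  refine UniformSpace.Completion.denseRange_coe.mono ?_
  rintro _ ⟨t, rfl⟩
  obtain ⟨n, c, f, rfl⟩ := AlgTensor.exists_eq_sum t
  have h : ((∑ i, c i • AlgTensor.pure (f i) : AlgTensor d H) : HilbertTensor d H)
      = ∑ i, c i • pure (f i) := by
    have := map_sum (UniformSpace.Completion.toComplL (𝕜 := ℝ) (E := AlgTensor d H))
      (fun i => c i • AlgTensor.pure (f i)) Finset.univ
    simp only [map_smul] at this
    exact this
  rw [h]
  exact Submodule.sum_mem _ fun i _ => Submodule.smul_mem _ _ (Submodule.subset_span ⟨_, rfl⟩)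

/-- Continuous linear maps on a Hilbert tensor power are determined by the simple tensors. -/
theorem ext_pure {E : Type*} [NormedAddCommGroup E] [NormedSpace ℝ E]
    {A B : HilbertTensor d H →L[ℝ] E} (h : ∀ f : Fin d → H, A (pure f) = B (pure f)) : A = B :=
  ContinuousLinearMap.ext_on
    ((Submodule.dense_iff_topologicalClosure_eq_top).2 topologicalClosure_span_range_pure)
    (by rintro _ ⟨f, rfl⟩; exact h f)

theorem orthonormal_pure {ι : Type*} {b : ι → H} (hb : Orthonormal ℝ b) :
    Orthonormal ℝ (fun j : Fin d → ι => (pure (fun l => b (j l)) : HilbertTensor d H)) := by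
  classical
  rw [orthonormal_iff_ite]
  intro j k
  rw [inner_pure]
  simp only [orthonormal_iff_ite.1 hb]
  by_cases h : j = k
  · simp [h]
  · obtain ⟨l, hl⟩ := Function.ne_iff.1 h
    rw [if_neg h]
    exact Finset.prod_eq_zero (Finset.mem_univ l) (if_neg hl)

/-- Multilinear expansion handles simple tensors with factors in the algebraic span of `b`. Such
families are dense in the finite product, and `pure` is continuous, so the closure contains every
simple tensor. -/
theorem topologicalClosure_span_pure_eq_top {ι : Type*} {b : ι → H}
    (hb : (Submodule.span ℝ (Set.range b)).topologicalClosure = ⊤) :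
    (Submodule.span ℝ (Set.range fun j : Fin d → ι =>
      (pure (fun l => b (j l)) : HilbertTensor d H))).topologicalClosure = ⊤ := by
  classical
  set P := Submodule.span ℝ (Set.range fun j : Fin d → ι =>
      (pure (fun l => b (j l)) : HilbertTensor d H)) with hP
  have h1 : ∀ f : Fin d → H, (∀ l, f l ∈ Submodule.span ℝ (Set.range b)) → pure f ∈ P := by
    intro f hf
    choose c hc using fun l => Finsupp.mem_span_range_iff_exists_finsupp.1 (hf l)
    have e : f = fun l => ∑ i ∈ (c l).support, c l i • b i := funext fun l => (hc l).symm
    rw [e, ← pureMultilinear_apply, MultilinearMap.map_sum_finset]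
    refine Submodule.sum_mem _ fun r _ => ?_
    rw [MultilinearMap.map_smul_univ]
    exact Submodule.smul_mem _ _ (Submodule.subset_span ⟨r, rfl⟩)
  have h2 : Dense {f : Fin d → H | ∀ l, f l ∈ Submodule.span ℝ (Set.range b)} := by
    have := dense_pi (Set.univ : Set (Fin d)) (s := fun _ : Fin d =>
      (Submodule.span ℝ (Set.range b) : Set H))
      (fun _ _ => Submodule.dense_iff_topologicalClosure_eq_top.2 hb)
    convert this using 1
    ext f
    simp
  have h3 : ∀ f : Fin d → H, pure f ∈ P.topologicalClosure := by
    intro f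
    have hc : IsClosed {f : Fin d → H | (pure f : HilbertTensor d H) ∈ P.topologicalClosure} :=
      P.isClosed_topologicalClosure.preimage continuous_pure
    have := hc.closure_subset_iff.2 (fun f hf => P.le_topologicalClosure (h1 f hf)) (h2 f)
    exact this
  rw [eq_top_iff, ← topologicalClosure_span_range_pure]
  refine Submodule.topologicalClosure_minimal _ (Submodule.span_le.2 ?_)
    P.isClosed_topologicalClosure
  rintro _ ⟨f, rfl⟩
  exact h3 f

/-- The Hilbert basis of a tensor power made of the tensor products of the elements of a Hilbert
basis. -/
noncomputable def basis {ι : Type*} (d : ℕ) (b : HilbertBasis ι ℝ H) :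
    HilbertBasis (Fin d → ι) ℝ (HilbertTensor d H) :=
  HilbertBasis.mk (orthonormal_pure b.orthonormal)
    (topologicalClosure_span_pure_eq_top b.dense_span).ge

theorem basis_apply {ι : Type*} (b : HilbertBasis ι ℝ H) (j : Fin d → ι) :
    basis d b j = pure fun l => b (j l) := by
  rw [basis, HilbertBasis.coe_mk]

/-- On simple tensors this is a reindexing of a product; `ext_pure` is then applied to one variable
at a time. -/
theorem inner_perm_perm (π : Equiv.Perm (Fin d)) (x y : HilbertTensor d H) :
    inner ℝ (perm H π x) (perm H π y) = inner ℝ x y := by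
  have h : ∀ f : Fin d → H,
      (innerSL ℝ (perm H π (pure f))).comp (perm H π) = innerSL ℝ (pure f) := by
    intro f
    refine ext_pure fun g => ?_
    simp only [ContinuousLinearMap.comp_apply, innerSL_apply_apply, perm_pure, inner_pure]
    exact Equiv.prod_comp π fun l => inner ℝ (f l) (g l)
  have h' : (innerSL ℝ (perm H π y)).comp (perm H π) = innerSL ℝ y := by
    refine ext_pure fun f => ?_
    have := congrArg (fun A => A y) (h f)
    simp only [ContinuousLinearMap.comp_apply, innerSL_apply_apply] at this ⊢
    rw [real_inner_comm, this, real_inner_comm]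
  have := congrArg (fun A => A x) h'
  simp only [ContinuousLinearMap.comp_apply, innerSL_apply_apply] at this
  rw [real_inner_comm, this, real_inner_comm]

/-- The order is reversed because `perm` acts by precomposition on the index. -/
theorem perm_perm (π σ : Equiv.Perm (Fin d)) (x : HilbertTensor d H) :
    perm H π (perm H σ x) = perm H (σ * π) x := by
  have : (perm H π).comp (perm H σ) = perm H (σ * π) := by
    refine ext_pure fun f => ?_
    simp only [ContinuousLinearMap.comp_apply, perm_pure, Equiv.Perm.mul_apply]
  exact congrArg (fun A => A x) this

theorem perm_one (x : HilbertTensor d H) : perm H (1 : Equiv.Perm (Fin d)) x = x := by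
  have : perm H (1 : Equiv.Perm (Fin d)) = ContinuousLinearMap.id ℝ _ := by
    refine ext_pure fun f => ?_
    simp [perm_pure]
  exact congrArg (fun A => A x) this

/-- If `b` diagonalizes `S†S`, then the tensor products of the elements of `b` diagonalize the
tensor power. -/
theorem inner_map_map_pure {ι : Type*} (S : H →L[ℝ] G) {b : ι → H} {μ : ι → ℝ}
    (hbμ : ∀ i x, inner ℝ (S x) (S (b i)) = μ i * inner ℝ x (b i)) (j : Fin d → ι)
    (x : HilbertTensor d H) :
    inner ℝ (map d S x) (map d S (pure fun l => b (j l)))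
      = (∏ l, μ (j l)) * inner ℝ x (pure fun l => b (j l)) := by
  have h : (innerSL ℝ (map d S (pure fun l => b (j l)))).comp (map d S)
      = (∏ l, μ (j l)) • innerSL ℝ (pure fun l => b (j l) : HilbertTensor d H) := by
    refine ext_pure fun f => ?_
    simp only [ContinuousLinearMap.comp_apply, innerSL_apply_apply, map_pure, inner_pure,
      _root_.smul_apply, smul_eq_mul]
    rw [← Finset.prod_mul_distrib]
    refine Finset.prod_congr rfl fun l _ => ?_
    rw [real_inner_comm, hbμ, real_inner_comm]
  have := congrArg (fun A => A x) h
  simp only [ContinuousLinearMap.comp_apply, innerSL_apply_apply,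
      _root_.smul_apply, smul_eq_mul] at this
  rw [real_inner_comm, this, real_inner_comm]

end HilbertTensor

/-- The norm bound for an operator `T` diagonalized by a Hilbert basis `e`, on vectors supported
where the squared singular values are at most `ε²`. -/
theorem norm_apply_le_of_diagonal {κ : Type*} {E F : Type*}
    [NormedAddCommGroup E] [InnerProductSpace ℝ E] [CompleteSpace E]
    [NormedAddCommGroup F] [InnerProductSpace ℝ F] [CompleteSpace F]
    (T : E →L[ℝ] F) (e : HilbertBasis κ ℝ E) (ν : κ → ℝ)
    (hT : ∀ j x, inner ℝ (T x) (T (e j)) = ν j * inner ℝ x (e j)) {ε : ℝ} (hε : 0 ≤ ε) (g : E)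
    (hg : ∀ j, ε ^ 2 < ν j → inner ℝ (e j) g = 0) : ‖T g‖ ≤ ε * ‖g‖ := by
  -- Parseval for `⟪T†T g, g⟫ = ‖T g‖ ^ 2` and for `‖g‖ ^ 2`; the two series are compared term by
  -- term.
  have h1 := e.hasSum_inner_mul_inner (ContinuousLinearMap.adjoint T (T g)) g
  have h2 := (e.hasSum_inner_mul_inner g g).mul_left (ε ^ 2)
  rw [ContinuousLinearMap.adjoint_inner_left, real_inner_self_eq_norm_sq] at h1
  rw [real_inner_self_eq_norm_sq, ← mul_pow] at h2
  refine le_of_sq_le_sq (hasSum_le (fun j => ?_) h1 h2) (by positivity)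
  rw [ContinuousLinearMap.adjoint_inner_left, hT, real_inner_comm (e j) g]
  by_cases hj : ε ^ 2 < ν j
  · simp [hg j hj]
  · rw [mul_assoc]
    exact mul_le_mul_of_nonneg_right (not_lt.1 hj) (mul_self_nonneg _)

end TensorBasis

/-! ### Basis coefficients of antisymmetric tensors. -/

section Antisymmetry

variable {d : ℕ} {H : Type*} [NormedAddCommGroup H] [InnerProductSpace ℝ H]

theorem mem_permsFixingCompl {I : Finset (Fin d)} {π : Equiv.Perm (Fin d)} :
    π ∈ permsFixingCompl I ↔ ∀ i, i ∉ I → π i = i := by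
  simp [permsFixingCompl]

theorem mul_mem_permsFixingCompl {I : Finset (Fin d)} {π σ : Equiv.Perm (Fin d)}
    (hπ : π ∈ permsFixingCompl I) (hσ : σ ∈ permsFixingCompl I) : π * σ ∈ permsFixingCompl I := by
  rw [mem_permsFixingCompl] at *
  intro i hi
  rw [Equiv.Perm.mul_apply, hσ i hi, hπ i hi]

theorem inv_mem_permsFixingCompl {I : Finset (Fin d)} {π : Equiv.Perm (Fin d)}
    (hπ : π ∈ permsFixingCompl I) : π⁻¹ ∈ permsFixingCompl I := by
  rw [mem_permsFixingCompl] at *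
  intro i hi
  rw [Equiv.Perm.inv_eq_iff_eq, hπ i hi]

theorem apply_mem_of_mem_permsFixingCompl {I : Finset (Fin d)} {π : Equiv.Perm (Fin d)}
    (hπ : π ∈ permsFixingCompl I) {i : Fin d} (hi : i ∈ I) : π i ∈ I := by
  by_contra h
  have := mem_permsFixingCompl.1 hπ _ h
  exact h ((π.injective this).symm ▸ hi)

theorem card_permsFixingCompl (I : Finset (Fin d)) :
    (permsFixingCompl I).card = I.card.factorial := by
  classical
  rw [permsFixingCompl, ← Fintype.card_subtype,
    ← Fintype.card_congr (Equiv.Perm.subtypeEquivSubtypePerm (· ∈ I)), Fintype.card_perm,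
    Fintype.card_coe]

/-- The substitution `σ ↦ σ * π` in the average absorbs the permutation and costs one factor `sign
π`. -/
theorem perm_of_mem_antisymSubspace {I : Finset (Fin d)} {π : Equiv.Perm (Fin d)}
    (hπ : π ∈ permsFixingCompl I) {f : HilbertTensor d H} (hf : f ∈ antisymSubspace H I) :
    HilbertTensor.perm H π f = ((Equiv.Perm.sign π : ℤ) : ℝ) • f := by
  obtain ⟨h, rfl⟩ := hf
  change HilbertTensor.perm H π (antisymmetrizer H I h) = _ • antisymmetrizer H I h
  simp only [antisymmetrizer, _root_.smul_apply, _root_.sum_apply, map_smul, map_sum,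
    HilbertTensor.perm_perm]
  rw [smul_comm]
  congr 1
  rw [Finset.smul_sum]
  refine Finset.sum_equiv (Equiv.mulRight π) (fun σ => ?_) fun σ _ => ?_
  · refine ⟨fun h => mul_mem_permsFixingCompl h hπ, fun h => ?_⟩
    have := mul_mem_permsFixingCompl h (inv_mem_permsFixingCompl hπ)
    simpa using this
  · rw [Equiv.coe_mulRight, smul_smul, Equiv.Perm.sign_mul]
    congr 1
    have : ((Equiv.Perm.sign π : ℤ) : ℝ) * ((Equiv.Perm.sign π : ℤ) : ℝ) = 1 := by
      rw [← Int.cast_mul, Int.units_coe_mul_self, Int.cast_one]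
    push_cast
    rw [mul_left_comm, this, mul_one]

/-- Since `perm` is isometric, the sign rule for `f` passes to its coefficients. This lets one
functional recover a whole orbit. -/
theorem inner_pure_comp_of_mem_antisymSubspace {I : Finset (Fin d)} {π : Equiv.Perm (Fin d)}
    (hπ : π ∈ permsFixingCompl I) {f : HilbertTensor d H} (hf : f ∈ antisymSubspace H I)
    (g : Fin d → H) :
    inner ℝ (HilbertTensor.pure fun l => g (π l)) f
      = ((Equiv.Perm.sign π : ℤ) : ℝ) * inner ℝ (HilbertTensor.pure g) f := by
  rw [← HilbertTensor.perm_pure, ← HilbertTensor.inner_perm_perm π (HilbertTensor.pure g) f,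
    perm_of_mem_antisymSubspace hπ hf, inner_smul_right, ← mul_assoc, ← Int.cast_mul,
    Int.units_coe_mul_self, Int.cast_one, one_mul]

/-- The transposition of `a` and `b` fixes `g` but is odd, so the coefficient equals its own
negative. -/
theorem inner_pure_eq_zero_of_mem_antisymSubspace {I : Finset (Fin d)} {f : HilbertTensor d H}
    (hf : f ∈ antisymSubspace H I) {a b : Fin d} (ha : a ∈ I) (hb : b ∈ I) (hab : a ≠ b)
    {g : Fin d → H} (hg : g a = g b) : inner ℝ (HilbertTensor.pure g) f = 0 := by
  have hπ : Equiv.swap a b ∈ permsFixingCompl I := mem_permsFixingCompl.2 fun i hi =>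
    Equiv.swap_apply_of_ne_of_ne (fun h => hi (h ▸ ha)) (fun h => hi (h ▸ hb))
  have h := inner_pure_comp_of_mem_antisymSubspace hπ hf g
  have e : (fun l => g (Equiv.swap a b l)) = g := by
    funext l
    rw [Equiv.swap_apply_def]
    split_ifs with h1 h2 <;> simp_all
  rw [e, Equiv.Perm.sign_swap hab] at h
  push_cast at h
  linarith

theorem antisymSubspace_eq_top_of_le_one (hd : d ≤ 1) (I : Finset (Fin d)) :
    antisymSubspace H I = ⊤ := by
  have : Subsingleton (Fin d) := Fin.subsingleton_iff_le_one.2 hd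
  have h1 : permsFixingCompl I = {1} := by
    ext π
    simp [mem_permsFixingCompl, Subsingleton.elim π 1]
  rw [eq_top_iff]
  rintro f -
  refine ⟨f, ?_⟩
  simp [antisymmetrizer, h1, HilbertTensor.perm_one]

/-- A finite set of families `Fin d → ι`, injective on `I` and invariant under the permutations of
the coordinates in `I`, is the orbit of a subset smaller by the factor `(#I)!`. -/
theorem exists_orbit_representatives {ι : Type*} (I : Finset (Fin d)) (K : Finset (Fin d → ι))
    (hinj : ∀ k ∈ K, Set.InjOn k I)
    (hK : ∀ k ∈ K, ∀ π ∈ permsFixingCompl I, (fun l => k (π l)) ∈ K) :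
    ∃ J : Finset (Fin d → ι), J.card * I.card.factorial ≤ K.card ∧
      ∀ k ∈ K, ∃ j ∈ J, ∃ π ∈ permsFixingCompl I, k = fun l => j (π l) := by
  classical
  let r : Setoid (Fin d → ι) :=
    { r := fun j k => ∃ π ∈ permsFixingCompl I, k = fun l => j (π l)
      iseqv :=
        { refl := fun j => ⟨1, mem_permsFixingCompl.2 fun _ _ => rfl, rfl⟩
          symm := by
            rintro j k ⟨π, hπ, rfl⟩
            exact ⟨π⁻¹, inv_mem_permsFixingCompl hπ, by simp⟩
          trans := by
            rintro j k m ⟨π, hπ, rfl⟩ ⟨σ, hσ, rfl⟩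
            exact ⟨π * σ, mul_mem_permsFixingCompl hπ hσ, rfl⟩ } }
  let rep : (Fin d → ι) → (Fin d → ι) := fun k => (Quotient.mk r k).out
  have hrep : ∀ k, ∃ π ∈ permsFixingCompl I, k = fun l => rep k (π l) := fun k =>
    Quotient.mk_out (s := r) k
  refine ⟨K.image rep, ?_, fun k hk => ⟨rep k, Finset.mem_image_of_mem _ hk, hrep k⟩⟩
  rw [Finset.card_eq_sum_card_image rep K, ← smul_eq_mul, ← nsmul_eq_smul]
  refine Finset.card_nsmul_le_sum _ _ _ fun j hj => ?_
  obtain ⟨k, hk, rfl⟩ := Finset.mem_image.1 hj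
  rw [← card_permsFixingCompl]
  -- Injectivity of `k` on `I` makes `π ↦ k ∘ π` injective, so each fibre of `rep` has at least
  -- `(#I)!` elements in `K`.
  refine Finset.card_le_card_of_injOn (fun π l => k (π l)) (fun π hπ => ?_) ?_
  · refine Finset.mem_coe.2 (Finset.mem_filter.2 ⟨hK k hk π hπ, ?_⟩)
    have : (Quotient.mk r (fun l => k (π l))) = Quotient.mk r k :=
      (Quotient.sound (s := r) ⟨π, hπ, rfl⟩).symm
    exact congrArg Quotient.out this
  · intro π hπ σ hσ h
    ext1 l
    by_cases hl : l ∈ I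
    · exact hinj k hk (apply_mem_of_mem_permsFixingCompl hπ hl)
        (apply_mem_of_mem_permsFixingCompl hσ hl) (congrFun h l)
    · rw [mem_permsFixingCompl.1 hπ l hl, mem_permsFixingCompl.1 hσ l hl]

end Antisymmetry

/-! ### Upper and lower bounds for adaptive algorithms. -/

section Algorithms

variable {F G : Type*} [NormedAddCommGroup F] [NormedSpace ℝ F]
  [NormedAddCommGroup G] [NormedSpace ℝ G]

theorem adaptiveInfo_nonadaptive (ℓ : ℕ → F →L[ℝ] ℝ) (f : F) (n : ℕ) :
    adaptiveInfo (fun k _ => ℓ k) f n = fun i : Fin n => ℓ i f := by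
  induction n with
  | zero => exact Subsingleton.elim _ _
  | succ n ih =>
    rw [adaptiveInfo, ih]
    funext i
    refine Fin.lastCases ?_ (fun i => ?_) i
    · simp
    · simp

/-- An input annihilated by the functionals chosen after zero data never makes the algorithm leave
the all-zero path, so adaptivity has no effect on it. -/
theorem adaptiveInfo_eq_zero (L : ∀ k : ℕ, (Fin k → ℝ) → (F →L[ℝ] ℝ)) (f : F) (n : ℕ)
    (h : ∀ k < n, L k 0 f = 0) : adaptiveInfo L f n = 0 := by
  induction n with
  | zero => exact Subsingleton.elim _ _
  | succ n ih =>
    rw [adaptiveInfo, ih fun k hk => h k (hk.trans n.lt_succ_self), h n n.lt_succ_self]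
    funext i
    refine Fin.lastCases ?_ (fun i => ?_) i
    · simp
    · simp

/-- A reconstruction from finitely many continuous linear functionals bounds the information
complexity by their number. -/
theorem infoComplexity_le_card {κ : Type*} [Fintype κ] (T : F →L[ℝ] G) (ℓ : κ → F →L[ℝ] ℝ)
    (ψ : (κ → ℝ) → G) {ε : ℝ}
    (h : ∀ f : F, ‖f‖ ≤ 1 → ‖ψ (fun i => ℓ i f) - T f‖ ≤ ε) :
    infoComplexity T ε ≤ Fintype.card κ := by
  let e := Fintype.equivFin κ
  let A : InfoAlgorithm F G (Fintype.card κ) :=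
    { L := fun k _ => if hk : k < Fintype.card κ then ℓ (e.symm ⟨k, hk⟩) else 0
      φ := fun y => ψ fun i => y (e i) }
  refine iInf₂_le (f := fun (n : ℕ) (_ : minimalError T n ≤ ENNReal.ofReal ε) => (n : ℕ∞))
    (Fintype.card κ) ((iInf_le _ A).trans (iSup₂_le fun f hf => ?_))
  have hA : A.eval f = ψ fun i => ℓ i f := by
    change ψ (fun i => adaptiveInfo A.L f _ (e i)) = _
    rw [adaptiveInfo_nonadaptive
      (fun k => if hk : k < Fintype.card κ then ℓ (e.symm ⟨k, hk⟩) else 0)]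
    simp
  rw [hA, ← ofReal_norm]
  exact ENNReal.ofReal_le_ofReal (h f hf)

/-- An operator that is bounded from below by `δ` on an `(n + 1)`-dimensional subspace cannot be
approximated better than up to `δ` from `n` functionals, even if they are chosen adaptively. -/
theorem le_minimalError (T : F →L[ℝ] G) {n : ℕ} {δ : ℝ} (v : Fin (n + 1) → F)
    (hv : LinearIndependent ℝ v)
    (hT : ∀ c : Fin (n + 1) → ℝ, δ * ‖∑ i, c i • v i‖ ≤ ‖T (∑ i, c i • v i)‖) :
    ENNReal.ofReal δ ≤ minimalError T n := by
  refine le_iInf fun A => ?_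
  let M : (Fin (n + 1) → ℝ) →ₗ[ℝ] (Fin n → ℝ) :=
    (LinearMap.pi fun k : Fin n => (A.L k 0).toLinearMap) ∘ₗ Fintype.linearCombination ℝ v
  -- The `n` functionals on the all-zero path impose `n` linear conditions on `n + 1` coefficients.
  have hM : LinearMap.ker M ≠ ⊥ := LinearMap.ker_ne_bot_of_finrank_lt (by simp)
  obtain ⟨c, hc, hc0⟩ := (Submodule.ne_bot_iff _).1 hM
  set f : F := ∑ i, c i • v i with hf
  have hf0 : f ≠ 0 := fun h => hc0 (funext fun i => Fintype.linearIndependent_iff.1 hv c h i)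
  have hLf : ∀ k < n, A.L k 0 f = 0 := fun k hk => by
    have := congrFun (LinearMap.mem_ker.1 hc) ⟨k, hk⟩
    simpa [M, Fintype.linearCombination_apply, hf] using this
  set x : F := ‖f‖⁻¹ • f with hx
  have hx1 : ‖x‖ = 1 := norm_smul_inv_norm hf0
  have hx2 : A.eval x = A.φ 0 := by
    rw [InfoAlgorithm.eval, adaptiveInfo_eq_zero]
    intro k hk
    rw [hx, map_smul, hLf k hk, smul_zero]
  have hx3 : A.eval (-x) = A.φ 0 := by
    rw [InfoAlgorithm.eval, adaptiveInfo_eq_zero]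
    intro k hk
    rw [hx, map_neg, map_smul, hLf k hk, smul_zero, neg_zero]
  have hx4 : δ ≤ ‖T x‖ := by
    have hpos : 0 < ‖f‖ := norm_pos_iff.2 hf0
    rw [hx, map_smul, norm_smul, norm_inv, norm_norm, ← div_eq_inv_mul, le_div_iff₀ hpos]
    exact hT c
  have h1 : ‖A.φ 0 - T x‖ₑ ≤ worstCaseError T A := by
    rw [← hx2]
    exact le_iSup₂ (f := fun f (_ : ‖f‖ ≤ 1) => ‖A.eval f - T f‖ₑ) x hx1.le
  have h2 : ‖A.φ 0 + T x‖ₑ ≤ worstCaseError T A := by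
    have := le_iSup₂ (f := fun f (_ : ‖f‖ ≤ 1) => ‖A.eval f - T f‖ₑ) (-x)
      (by rw [norm_neg, hx1])
    rwa [hx3, map_neg, sub_neg_eq_add] at this
  -- The inputs `x` and `-x` yield the same output, while their images are `2 * ‖T x‖` apart.
  have h3 : δ ≤ max ‖A.φ 0 - T x‖ ‖A.φ 0 + T x‖ := by
    have h4 : (2 : ℝ) * ‖T x‖ ≤ ‖A.φ 0 - T x‖ + ‖A.φ 0 + T x‖ := by
      have := norm_sub_le (A.φ 0 + T x) (A.φ 0 - T x)
      rw [show A.φ 0 + T x - (A.φ 0 - T x) = (2 : ℝ) • T x by rw [two_smul]; abel, norm_smul] at this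
      simp at this
      linarith
    have := le_max_left ‖A.φ 0 - T x‖ ‖A.φ 0 + T x‖
    have := le_max_right ‖A.φ 0 - T x‖ ‖A.φ 0 + T x‖
    linarith
  rw [← ofReal_norm] at h1 h2
  rcases le_max_iff.1 h3 with h | h
  · exact (ENNReal.ofReal_le_ofReal h).trans h1
  · exact (ENNReal.ofReal_le_ofReal h).trans h2

end Algorithms

/-- `n + 1` orthonormal singular directions with squared singular values above `ε²` force the
information complexity to be larger than `n`. -/
theorem lt_infoComplexity_of_singular {F G : Type*} [NormedAddCommGroup F] [InnerProductSpace ℝ F]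
    [NormedAddCommGroup G] [InnerProductSpace ℝ G] (T : F →L[ℝ] G) {n : ℕ} {ε δ : ℝ}
    (hε : 0 ≤ ε) (hδ : ε < δ) (v : Fin (n + 1) → F) (hv : Orthonormal ℝ v) (ν : Fin (n + 1) → ℝ)
    (hT : ∀ i x, inner ℝ (T x) (T (v i)) = ν i * inner ℝ x (v i)) (hν : ∀ i, δ ^ 2 ≤ ν i) :
    ((n + 1 : ℕ) : ℕ∞) ≤ infoComplexity T ε := by
  refine le_iInf₂ fun m hm => ?_
  rw [Nat.cast_le]
  by_contra! hmn
  have hmn' : m + 1 ≤ n + 1 := hmn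
  -- If `m ≤ n` functionals sufficed, the first `m + 1` directions would already give error at least
  -- `δ > ε`.
  have key := le_minimalError T (n := m) (δ := δ) (fun i => v (Fin.castLE hmn' i))
    (hv.comp _ (Fin.castLE_injective hmn')).linearIndependent fun c => ?_
  · exact (key.trans hm).not_gt ((ENNReal.ofReal_lt_ofReal_iff (hε.trans_lt hδ)).2 hδ)
  · have hv' := hv.comp _ (Fin.castLE_injective hmn')
    set w : Fin (m + 1) → F := fun i => v (Fin.castLE hmn' i) with hw
    set x : F := ∑ i, c i • w i with hx
    have hxw : ∀ i, inner ℝ x (w i) = c i := fun i => by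
      rw [real_inner_comm]
      exact hv'.inner_right_fintype c i
    have e1 : ‖x‖ ^ 2 = ∑ i, c i * c i := by
      rw [← real_inner_self_eq_norm_sq]
      nth_rewrite 2 [hx]
      rw [inner_sum]
      exact Finset.sum_congr rfl fun i _ => by rw [inner_smul_right, hxw]
    have e2 : ‖T x‖ ^ 2 = ∑ i, c i * (ν (Fin.castLE hmn' i) * c i) := by
      have hTx : T x = ∑ i, c i • T (w i) := by
        rw [hx, map_sum]
        exact Finset.sum_congr rfl fun i _ => map_smul _ _ _
      rw [← real_inner_self_eq_norm_sq]
      nth_rewrite 2 [hTx]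
      rw [inner_sum]
      exact Finset.sum_congr rfl fun i _ => by rw [inner_smul_right, hT, hxw i]
    refine le_of_sq_le_sq ?_ (norm_nonneg _)
    rw [mul_pow, e1, e2, Finset.mul_sum]
    refine Finset.sum_le_sum fun i _ => ?_
    have := mul_le_mul_of_nonneg_right (hν (Fin.castLE hmn' i)) (mul_self_nonneg (c i))
    linarith

/-! ### Counting basis tuples and the approximating algorithm. -/

section UpperBound

variable {H : Type*} [NormedAddCommGroup H] [InnerProductSpace ℝ H]
  {G : Type*} [NormedAddCommGroup G] [InnerProductSpace ℝ G]

/-- Markov's inequality: each tuple in `K` contributes at least `ε ^ (2τ)` to a sum over all tuples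
that factors as a `d`-th power. The finite set `s` of occurring indices keeps every sum finite. -/
theorem card_le_of_lt_prod {ι : Type*} {μ : ι → ℝ} (hμ : ∀ i, 0 ≤ μ i) {τ Λ : ℝ} (hτ : 0 < τ)
    (hΛ : ∀ s : Finset ι, ∑ i ∈ s, μ i ^ τ ≤ Λ) {d : ℕ} {ε : ℝ} (hε : 0 < ε)
    (K : Finset (Fin d → ι)) (hK : ∀ j ∈ K, ε ^ 2 < ∏ l, μ (j l)) :
    (K.card : ℝ) ≤ ε ^ (-(2 * τ)) * Λ ^ d := by
  classical
  set s : Finset ι := K.biUnion fun j => Finset.univ.image j with hs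
  have hsub : K ⊆ Fintype.piFinset fun _ : Fin d => s := fun j hj =>
    Fintype.mem_piFinset.2 fun l =>
      Finset.mem_biUnion.2 ⟨j, hj, Finset.mem_image_of_mem j (Finset.mem_univ l)⟩
  have h1 : (K.card : ℝ) * ε ^ (2 * τ) ≤ Λ ^ d := by
    calc (K.card : ℝ) * ε ^ (2 * τ) = ∑ _j ∈ K, ε ^ (2 * τ) := by
          rw [Finset.sum_const, nsmul_eq_mul]
      _ ≤ ∑ j ∈ K, ∏ l, μ (j l) ^ τ := Finset.sum_le_sum fun j hj => by
          rw [Real.rpow_mul hε.le, Real.finsetProd_rpow _ _ fun i _ => hμ _, Real.rpow_two]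
          exact Real.rpow_le_rpow (by positivity) (hK j hj).le hτ.le
      _ ≤ ∑ j ∈ Fintype.piFinset fun _ : Fin d => s, ∏ l, μ (j l) ^ τ :=
          Finset.sum_le_sum_of_subset_of_nonneg hsub fun j _ _ =>
            Finset.prod_nonneg fun l _ => Real.rpow_nonneg (hμ _) _
      _ = (∑ i ∈ s, μ i ^ τ) ^ d := by
          rw [← Finset.prod_univ_sum (fun _ : Fin d => s) fun _ i => μ i ^ τ]
          simp
      _ ≤ Λ ^ d := pow_le_pow_left₀
          (Finset.sum_nonneg fun i _ => Real.rpow_nonneg (hμ i) _) (hΛ s) d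
  rw [Real.rpow_neg hε.le, ← div_eq_inv_mul, le_div_iff₀ (Real.rpow_pos_of_pos hε _)]
  exact h1

/-- The algorithm projects `f` onto the basis tensors with eigenvalue above `ε ^ 2` and tuple
injective on `I`, reading only one coefficient per orbit and restoring the others by sign. -/
theorem exists_infoComplexity_antisymProblem_le (S : H →L[ℝ] G)
    {ι : Type*} (b : HilbertBasis ι ℝ H) {μ : ι → ℝ} (hμ : ∀ i, 0 ≤ μ i)
    (hbμ : ∀ i x, inner ℝ (S x) (S (b i)) = μ i * inner ℝ x (b i)) {τ Λ : ℝ} (hτ : 0 < τ)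
    (hΛ : ∀ s : Finset ι, ∑ i ∈ s, μ i ^ τ ≤ Λ) {d : ℕ} (I : Finset (Fin d)) {ε : ℝ} (hε : 0 < ε) :
    ∃ n : ℕ, infoComplexity (antisymProblem S I) ε ≤ n ∧
      (n : ℝ) ≤ ε ^ (-(2 * τ)) * (Λ ^ d / (I.card.factorial : ℝ)) := by
  classical
  set e := HilbertTensor.basis d b with he
  have hinner : ∀ j x, inner ℝ (HilbertTensor.map d S x) (HilbertTensor.map d S (e j))
      = (∏ l, μ (j l)) * inner ℝ x (e j) := fun j x => by
    rw [he, HilbertTensor.basis_apply]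
    exact HilbertTensor.inner_map_map_pure S hbμ j x
  set Kset : Set (Fin d → ι) := {j | Set.InjOn j I ∧ ε ^ 2 < ∏ l, μ (j l)} with hKset
  have hfin : Kset.Finite := by
    -- The Markov bound is uniform over finite subsets, so it also yields finiteness.
    by_contra hinf
    obtain ⟨m, hm⟩ := exists_nat_gt (ε ^ (-(2 * τ)) * Λ ^ d)
    obtain ⟨K, hK, rfl⟩ := Set.Infinite.exists_subset_card_eq hinf m
    exact hm.not_ge (card_le_of_lt_prod hμ hτ hΛ hε K fun j hj => (hK hj).2)
  set K : Finset (Fin d → ι) := hfin.toFinset with hKdef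
  have hK : ∀ j, j ∈ K ↔ Set.InjOn j I ∧ ε ^ 2 < ∏ l, μ (j l) := fun j => by
    rw [hKdef, Set.Finite.mem_toFinset, hKset, Set.mem_ofPred_eq]
  have hinv : ∀ k ∈ K, ∀ π ∈ permsFixingCompl I, (fun l => k (π l)) ∈ K := by
    refine fun k hk π hπ => (hK _).2 ⟨fun x hx y hy hxy => ?_, ?_⟩
    · exact π.injective (((hK k).1 hk).1 (apply_mem_of_mem_permsFixingCompl hπ hx)
        (apply_mem_of_mem_permsFixingCompl hπ hy) hxy)
    · rw [Equiv.prod_comp π fun l => μ (k l)]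
      exact ((hK k).1 hk).2
  obtain ⟨J, hJcard, hJ⟩ :=
    exists_orbit_representatives I K (fun k hk => ((hK k).1 hk).1) hinv
  refine ⟨J.card, ?_, ?_⟩
  · choose! r hrJ π hπ hr using hJ
    have hcoef : ∀ f ∈ antisymSubspace H I, ∀ k ∈ K,
        inner ℝ (e k) f = ((Equiv.Perm.sign (π k) : ℤ) : ℝ) * inner ℝ (e (r k)) f := by
      intro f hf k hk
      rw [he, HilbertTensor.basis_apply, HilbertTensor.basis_apply,
        ← inner_pure_comp_of_mem_antisymSubspace (hπ k hk) hf]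
      conv_lhs => rw [hr k hk]
    rw [← Fintype.card_coe]
    refine infoComplexity_le_card _
      (fun j : J => (innerSL ℝ (e j)).comp (antisymSubspace H I).subtypeL)
      (fun y => ∑ k ∈ K.attach, (((Equiv.Perm.sign (π k) : ℤ) : ℝ) * y ⟨r k, hrJ k k.2⟩) •
        HilbertTensor.map d S (e k)) fun ⟨f, hf⟩ hf1 => ?_
    set p : HilbertTensor d H := ∑ k ∈ K, inner ℝ (e k) f • e k with hp
    have hψ : (∑ k ∈ K.attach, (((Equiv.Perm.sign (π k) : ℤ) : ℝ) *
        ((innerSL ℝ (e (r k))).comp (antisymSubspace H I).subtypeL) ⟨f, hf⟩) •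
        HilbertTensor.map d S (e k)) = HilbertTensor.map d S p := by
      rw [hp, map_sum, ← Finset.sum_attach K]
      refine Finset.sum_congr rfl fun k _ => ?_
      rw [map_smul, hcoef f hf k k.2]
      rfl
    have hg : ∀ j, inner ℝ (e j) (f - p) = if j ∈ K then 0 else inner ℝ (e j) f := by
      intro j
      rw [inner_sub_right]
      by_cases hj : j ∈ K
      · rw [hp, e.orthonormal.inner_right_sum _ hj, if_pos hj, sub_self]
      · have : inner ℝ (e j) p = 0 := by
          rw [hp, inner_sum]
          refine Finset.sum_eq_zero fun k hk => ?_
          rw [inner_smul_right, e.orthonormal.2 (ne_of_mem_of_not_mem hk hj).symm, mul_zero]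
        rw [this, if_neg hj, sub_zero]
    have horth : inner ℝ (f - p) p = 0 := by
      nth_rewrite 2 [hp]
      rw [inner_sum]
      refine Finset.sum_eq_zero fun k hk => ?_
      rw [inner_smul_right, real_inner_comm (e k), hg, if_pos hk, mul_zero]
    have hle : ‖f - p‖ ≤ ‖f‖ := by
      have := norm_add_sq_eq_norm_sq_add_norm_sq_real horth
      rw [sub_add_cancel] at this
      nlinarith [norm_nonneg (f - p), norm_nonneg f, norm_nonneg p]
    -- A coefficient of `f - p` above the threshold vanishes for one of two reasons: the projection
    -- removed it, or its tuple repeats an index on `I`.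
    have hT := norm_apply_le_of_diagonal (HilbertTensor.map d S) e _ hinner hε.le (f - p)
      fun j hj => by
        rw [hg]
        split_ifs with hjK
        · rfl
        · have : ¬ Set.InjOn j I := fun h => hjK ((hK j).2 ⟨h, hj⟩)
          simp only [Set.InjOn, not_forall] at this
          obtain ⟨x, hx, y, hy, hxy, hne⟩ := this
          rw [he, HilbertTensor.basis_apply]
          exact inner_pure_eq_zero_of_mem_antisymSubspace hf hx hy hne (congrArg b hxy)
    calc _ = ‖HilbertTensor.map d S p - HilbertTensor.map d S f‖ := by rw [← hψ]; rfl
      _ = ‖HilbertTensor.map d S (f - p)‖ := by rw [map_sub, norm_sub_rev]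
      _ ≤ ε * ‖f - p‖ := hT
      _ ≤ ε * 1 := by gcongr; exact hle.trans hf1
      _ = ε := mul_one ε
  · rw [← mul_div_assoc, le_div_iff₀ (by positivity)]
    refine le_trans ?_ (card_le_of_lt_prod hμ hτ hΛ hε K fun j hj => ((hK j).1 hj).2)
    exact_mod_cast hJcard

theorem stronglyPolynomiallyTractable_of_bounded (S : H →L[ℝ] G)
    {ι : Type*} (b : HilbertBasis ι ℝ H) {μ : ι → ℝ} (hμ : ∀ i, 0 ≤ μ i)
    (hbμ : ∀ i x, inner ℝ (S x) (S (b i)) = μ i * inner ℝ x (b i)) {τ Λ M : ℝ} (hτ : 0 < τ)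
    (hΛ : ∀ s : Finset ι, ∑ i ∈ s, μ i ^ τ ≤ Λ) (I : ∀ d : ℕ, Finset (Fin d))
    (hM : ∀ d, Λ ^ d / ((I d).card.factorial : ℝ) ≤ M) :
    StronglyPolynomiallyTractable (fun ε d => infoComplexity (antisymProblem S (I d)) ε) := by
  -- `max M 1` keeps the constant positive; the factor `2` comes from counting squared singular
  -- values.
  refine ⟨max M 1, 2 * τ, by positivity, by positivity, fun d _ ε hε _ => ?_⟩
  obtain ⟨n, h1, h2⟩ := exists_infoComplexity_antisymProblem_le S b hμ hbμ hτ hΛ (I d) hε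
  refine (ENat.toENNReal_le.2 h1).trans ?_
  rw [ENat.toENNReal_coe, ← ENNReal.ofReal_natCast]
  refine ENNReal.ofReal_le_ofReal (h2.trans ?_)
  rw [Real.rpow_zero, mul_one, mul_comm]
  exact mul_le_mul_of_nonneg_right ((hM d).trans (le_max_left _ _)) (Real.rpow_nonneg hε.le _)

end UpperBound

/-! ### Real estimates: power against factorial, and summability. -/

section Growth

/-- For `d ≥ d₀` one has `d ≤ #I / c`, hence `B ^ d ≤ (B ^ (1 / c)) ^ #I`, and `x ^ n / n! ≤ exp x`
finishes. Taking `B ≥ 1` makes powers monotone in the exponent, which also covers `d ≤ d₀`. -/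
theorem exists_pow_div_factorial_le {I : ∀ d : ℕ, Finset (Fin d)} (hI : CardGrowsLinearly I)
    (Λ : ℝ) (hΛ : 0 ≤ Λ) : ∃ M : ℝ, ∀ d, Λ ^ d / ((I d).card.factorial : ℝ) ≤ M := by
  obtain ⟨c, hc, d₀, h⟩ := hI
  set B := max Λ 1 with hB
  have hB1 : 1 ≤ B := le_max_right _ _
  refine ⟨max (B ^ d₀) (Real.exp (B ^ (1 / c))), fun d => ?_⟩
  have hf : (1 : ℝ) ≤ ((I d).card.factorial : ℝ) := by exact_mod_cast Nat.factorial_pos _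
  have hle : Λ ^ d ≤ B ^ d := pow_le_pow_left₀ hΛ (le_max_left _ _) d
  rcases le_total d d₀ with hd | hd
  · refine le_max_of_le_left ((div_le_self (by positivity) hf).trans (hle.trans ?_))
    exact pow_le_pow_right₀ hB1 hd
  · refine le_max_of_le_right (le_trans ?_
      (Real.pow_div_factorial_le_exp (B ^ (1 / c)) (by positivity) (I d).card))
    refine div_le_div_of_nonneg_right (hle.trans ?_) (by positivity)
    rw [← Real.rpow_natCast, ← Real.rpow_natCast, ← Real.rpow_mul (by positivity)]
    refine Real.rpow_le_rpow_of_exponent_le hB1 ?_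
    rw [one_div, ← div_eq_inv_mul, le_div_iff₀ hc, mul_comm]
    exact h d hd

/-- Raising the exponent by `x` gains a factor `a 0 ^ x`, which tends to `0`. -/
theorem exists_tsum_rpow_le_one {a : ℕ → ℝ} (ha : Antitone a) (ha0 : ∀ m, 0 ≤ a m) (h1 : a 0 < 1)
    {τ : ℝ} (hτ : 0 < τ) (hs : Summable fun m => a m ^ τ) :
    ∃ σ : ℝ, 0 < σ ∧ (Summable fun m => a m ^ σ) ∧ ∑' m, a m ^ σ ≤ 1 := by
  have ht := (tendsto_rpow_atTop_of_base_lt_one (a 0) (by linarith [ha0 0]) h1).mul_const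
    (∑' m, a m ^ τ)
  rw [zero_mul] at ht
  obtain ⟨x, hx, hx0⟩ := ((ht.eventually (gt_mem_nhds one_pos)).and
    (Filter.eventually_gt_atTop 0)).exists
  have hle : ∀ m, a m ^ (x + τ) ≤ a 0 ^ x * a m ^ τ := fun m => by
    rw [Real.rpow_add_of_nonneg (ha0 m) hx0.le hτ.le]
    exact mul_le_mul_of_nonneg_right (Real.rpow_le_rpow (ha0 m) (ha (Nat.zero_le m)) hx0.le)
      (Real.rpow_nonneg (ha0 m) _)
  have hs' : Summable fun m => a m ^ (x + τ) :=
    Summable.of_nonneg_of_le (fun m => Real.rpow_nonneg (ha0 m) _) hle (hs.mul_left _)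
  refine ⟨x + τ, by positivity, hs', ?_⟩
  refine (hs'.tsum_le_tsum hle (hs.mul_left _)).trans ?_
  rw [tsum_mul_left]
  exact hx.le

/-- Zero terms drop out because `τ > 0`, and the positive ones embed into the sequence. -/
theorem sum_rpow_le_tsum_of_injective {ι : Type*} {μ : ι → ℝ} {lam : ℕ → ℝ} (hμ : ∀ i, 0 ≤ μ i)
    (hlam : ∀ m, 0 ≤ lam m) (g : {i // 0 < μ i} → ℕ) (hg : Function.Injective g)
    (hgμ : ∀ i, lam (g i) = μ i) {τ : ℝ} (hτ : 0 < τ) (hs : Summable fun m => lam m ^ τ)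
    (s : Finset ι) : ∑ i ∈ s, μ i ^ τ ≤ ∑' m, lam m ^ τ := by
  classical
  have h1 : ∑ i ∈ s, μ i ^ τ = ∑ i ∈ s with 0 < μ i, μ i ^ τ := by
    refine (Finset.sum_filter_of_ne fun i _ hi => (hμ i).lt_of_ne fun h => hi ?_).symm
    rw [← h, Real.zero_rpow hτ.ne']
  rw [h1, ← Finset.sum_subtype_eq_sum_filter]
  calc _ = ∑ i ∈ s.subtype fun i => 0 < μ i, lam (g i) ^ τ :=
        Finset.sum_congr rfl fun i _ => by rw [hgμ]
    _ = ∑ m ∈ (s.subtype fun i => 0 < μ i).image g, lam m ^ τ :=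
        (Finset.sum_image (f := fun m => lam m ^ τ) hg.injOn).symm
    _ ≤ _ := hs.sum_le_tsum _ fun m _ => Real.rpow_nonneg (hlam m) _

/-- If `n + 1 ≤ C ε^{-p}` whenever `a n > ε²`, then the sequence `a` is `p`-summable. -/
theorem summable_rpow_of_counting {a : ℕ → ℝ} (ha : Antitone a) (ha0 : ∀ m, 0 ≤ a m) {C p : ℝ}
    (hC : 0 < C) (hp : 0 < p)
    (h : ∀ n ε, 0 < ε → ε ≤ 1 → ε ^ 2 < a n → (n + 1 : ℝ) ≤ C * ε ^ (-p)) :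
    Summable fun m => a m ^ p := by
  -- With `t = √(a n)` and `ε = min 1 (t / 2)`, this `R` gives `t ≤ R * ε` in both cases of the
  -- minimum: `R ≥ 2` for `t / 2`, and `R ≥ √(a 0)` for `1`.
  set R : ℝ := 2 + √(a 0) with hR
  have hR2 : 2 ≤ R := by simp [hR]
  -- The counting bound gives `ε ^ p ≤ C / (n + 1)`. Since `a n` is of order `ε ^ 2`, the exponent
  -- `p` on `a n` squares this into a summable majorant.
  have hb : ∀ n, a n ^ p ≤ R ^ (2 * p) * C ^ 2 * (1 / ((n : ℝ) + 1) ^ 2) := by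
    intro n
    rcases (ha0 n).eq_or_lt with h0 | h0
    · rw [← h0, Real.zero_rpow hp.ne']
      positivity
    set t : ℝ := √(a n) with ht
    have ht0 : 0 < t := Real.sqrt_pos.2 h0
    have ht2 : t ^ 2 = a n := Real.sq_sqrt h0.le
    have htR : t ≤ √(a 0) := Real.sqrt_le_sqrt (ha (Nat.zero_le n))
    set ε : ℝ := min 1 (t / 2) with hε
    have hε0 : 0 < ε := lt_min one_pos (by positivity)
    have hεt : ε ≤ t / 2 := min_le_right _ _
    have htε : t ≤ R * ε := by
      rcases min_choice 1 (t / 2) with h1 | h1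
      · rw [hε, h1]
        linarith
      · rw [hε, h1]
        nlinarith
    have key := h n ε hε0 (min_le_left _ _) (by rw [← ht2]; nlinarith)
    rw [Real.rpow_neg hε0.le, ← div_eq_mul_inv, le_div_iff₀ (Real.rpow_pos_of_pos hε0 _)] at key
    have key' : ε ^ p ≤ C / ((n : ℝ) + 1) := by
      rw [le_div_iff₀ (by positivity), mul_comm]
      exact key
    calc a n ^ p = t ^ (2 * p) := by rw [Real.rpow_mul ht0.le, Real.rpow_two, ht2]
      _ ≤ (R * ε) ^ (2 * p) := Real.rpow_le_rpow ht0.le htε (by positivity)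
      _ = R ^ (2 * p) * (ε ^ p) ^ 2 := by
          rw [Real.mul_rpow (by linarith) hε0.le, mul_comm 2 p, Real.rpow_mul hε0.le, Real.rpow_two]
      _ ≤ R ^ (2 * p) * (C / ((n : ℝ) + 1)) ^ 2 := by gcongr
      _ = _ := by rw [div_pow]; ring
  refine Summable.of_nonneg_of_le (fun m => Real.rpow_nonneg (ha0 m) _) hb (Summable.mul_left _ ?_)
  have := (summable_nat_add_iff 1).2 (Real.summable_one_div_nat_pow.2 one_lt_two)
  simpa using this

theorem memℓp_ofReal_iff_summable {a : ℕ → ℝ} (ha : ∀ m, 0 ≤ a m) {τ : ℝ} (hτ : 0 < τ) :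
    Memℓp a (ENNReal.ofReal τ) ↔ Summable fun m => a m ^ τ := by
  rw [memℓp_gen_iff (by rwa [ENNReal.toReal_ofReal hτ.le]), ENNReal.toReal_ofReal hτ.le]
  simp only [Real.norm_eq_abs, abs_of_nonneg (ha _)]

end Growth

/-! ### Assembling the equivalences. -/

section Equivalence

universe u

variable {H : Type u} [NormedAddCommGroup H] [InnerProductSpace ℝ H]
  {G : Type*} [NormedAddCommGroup G] [InnerProductSpace ℝ G]

/-- The univariate problem has information complexity larger than `n` if `ε²` is smaller than
`n + 1` squared singular values. -/
theorem lt_infoComplexity_antisymProblem_one (S : H →L[ℝ] G)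
    {ι : Type*} (b : HilbertBasis ι ℝ H) {μ : ι → ℝ}
    (hbμ : ∀ i x, inner ℝ (S x) (S (b i)) = μ i * inner ℝ x (b i)) (I : Finset (Fin 1)) {n : ℕ}
    {ε δ : ℝ} (hε : 0 ≤ ε) (hεδ : ε < δ) (g : Fin (n + 1) → ι) (hg : Function.Injective g)
    (hμ : ∀ i, δ ^ 2 ≤ μ (g i)) :
    ((n + 1 : ℕ) : ℕ∞) ≤ infoComplexity (antisymProblem S I) ε := by
  have htop : ∀ x, x ∈ antisymSubspace H I := fun x => by
    rw [antisymSubspace_eq_top_of_le_one le_rfl]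
    trivial
  have ho : Orthonormal ℝ fun i : Fin (n + 1) =>
      (HilbertTensor.pure fun _ => b (g i) : HilbertTensor 1 H) :=
    (HilbertTensor.orthonormal_pure (d := 1) b.orthonormal).comp (fun i _ => g i)
      fun i j h => hg (congrFun h 0)
  refine lt_infoComplexity_of_singular (antisymProblem S I) hε hεδ
    (fun i => ⟨HilbertTensor.pure fun _ => b (g i), htop _⟩)
    (ho.codRestrict _ fun i => htop _) (fun i => μ (g i)) (fun i x => ?_) hμ
  have := HilbertTensor.inner_map_map_pure S hbμ (fun _ : Fin 1 => g i) x
  rwa [Fin.prod_univ_one] at this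

variable [CompleteSpace H] [CompleteSpace G]

/-- A compact operator has a Hilbert basis of right singular vectors, and its squared singular
values are the given eigenvalue sequence up to order and zeros. -/
theorem exists_hilbertBasis_singular (S : H →L[ℝ] G) (hS : IsCompactOperator S) {lam : ℕ → ℝ}
    (hlam : IsEigenvalueSequence ((ContinuousLinearMap.adjoint S).comp S) lam) :
    ∃ (ι : Type u) (b : HilbertBasis ι ℝ H) (μ : ι → ℝ), (∀ i, 0 ≤ μ i) ∧
      (∀ i x, inner ℝ (S x) (S (b i)) = μ i * inner ℝ x (b i)) ∧
      (∃ g : {i // 0 < μ i} → ℕ, Function.Injective g ∧ ∀ i, lam (g i) = μ i) ∧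
      ∃ h : {m // 0 < lam m} → ι, Function.Injective h ∧ ∀ m, μ (h m) = lam m := by
  set W := (ContinuousLinearMap.adjoint S).comp S with hW
  have hinner : ∀ x y, inner ℝ (S x) (S y) = inner ℝ x (W y) := fun x y => by
    rw [hW, ContinuousLinearMap.comp_apply, ContinuousLinearMap.adjoint_inner_right]
  have hsymm : W.toLinearMap.IsSymmetric := fun x y => by
    change inner ℝ (W x) y = inner ℝ x (W y)
    rw [← hinner, real_inner_comm, ← hinner, real_inner_comm]
  obtain ⟨ι, b, μ, hb, hμ⟩ :=
    exists_hilbertBasis_eigenvectors W (hS.clm_comp (ContinuousLinearMap.adjoint S)) hsymm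
  have hbμ : ∀ i x, inner ℝ (S x) (S (b i)) = μ i * inner ℝ x (b i) := fun i x => by
    rw [hinner, hb, inner_smul_right]
  -- Both families list each positive `t` as often as the dimension of its eigenspace.
  have hcard : ∀ t : ℝ, 0 < t → {i | μ i = t}.encard = {m | lam m = t}.encard := fun t ht => by
    rw [(hμ t ht.ne').2, hlam.2.2 t ht]
  refine ⟨ι, b, μ, fun i => ?_, hbμ, ?_, ?_⟩
  · have h := hbμ i (b i)
    rw [real_inner_self_eq_norm_sq, real_inner_self_eq_norm_sq, b.orthonormal.1, one_pow,
      mul_one] at h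
    exact h ▸ sq_nonneg _
  · exact exists_injective_of_encard_fiber_eq μ lam hcard fun t ht => (hμ t ht.ne').1
  · refine exists_injective_of_encard_fiber_eq lam μ (fun t ht => (hcard t ht).symm) fun t ht => ?_
    rw [← Set.encard_lt_top_iff, ← hcard t ht, Set.encard_lt_top_iff]
    exact (hμ t ht.ne').1

/-- Only `d = 1` enters: there the factor `d ^ q` is `1` and the antisymmetry condition is void. -/
theorem exists_memℓp_of_polynomiallyTractable (S : H →L[ℝ] G) (hS : IsCompactOperator S)
    {lam : ℕ → ℝ} (hlam : IsEigenvalueSequence ((ContinuousLinearMap.adjoint S).comp S) lam)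
    (I : ∀ d : ℕ, Finset (Fin d))
    (h : PolynomiallyTractable (fun ε d => infoComplexity (antisymProblem S (I d)) ε)) :
    ∃ τ : ℝ, 0 < τ ∧ Memℓp lam (ENNReal.ofReal τ) := by
  obtain ⟨ι, b, μ, -, hbμ, -, g, hg, hgμ⟩ := exists_hilbertBasis_singular S hS hlam
  obtain ⟨C, p, q, hC, hp, -, hbound⟩ := h
  refine ⟨p, hp, (memℓp_ofReal_iff_summable hlam.2.1 hp).2
    (summable_rpow_of_counting hlam.1 hlam.2.1 hC hp fun n ε hε hε1 hn => ?_)⟩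
  have hle : ∀ i : Fin (n + 1), lam n ≤ lam i := fun i => hlam.1 (Nat.le_of_lt_succ i.2)
  have hpos : 0 < lam n := (sq_nonneg ε).trans_lt hn
  -- Here `δ = √(lam n)`; the `n + 1` directions belong to `lam 0, …, lam n`, all at least `lam n >
  -- 0`.
  have h1 := lt_infoComplexity_antisymProblem_one S b hbμ (I 1) hε.le
    ((Real.lt_sqrt hε.le).2 hn) (fun i : Fin (n + 1) => g ⟨i, hpos.trans_le (hle i)⟩)
    (fun i j hij => Fin.ext (congrArg Subtype.val (hg hij)))
    (fun i => by rw [hgμ, Real.sq_sqrt hpos.le]; exact hle i)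
  have h2 := (ENat.toENNReal_le.2 h1).trans (hbound 1 le_rfl ε hε hε1)
  rw [ENat.toENNReal_coe, ← ENNReal.ofReal_natCast, Nat.cast_one, Real.one_rpow, mul_one,
    ENNReal.ofReal_le_ofReal_iff (mul_nonneg hC.le (Real.rpow_nonneg hε.le _))] at h2
  exact_mod_cast h2

theorem stronglyPolynomiallyTractable_of_memℓp (S : H →L[ℝ] G) (hS : IsCompactOperator S)
    {lam : ℕ → ℝ} (hlam : IsEigenvalueSequence ((ContinuousLinearMap.adjoint S).comp S) lam)
    (I : ∀ d : ℕ, Finset (Fin d)) (hI : lam 0 < 1 ∨ CardGrowsLinearly I)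
    (h : ∃ τ : ℝ, 0 < τ ∧ Memℓp lam (ENNReal.ofReal τ)) :
    StronglyPolynomiallyTractable (fun ε d => infoComplexity (antisymProblem S (I d)) ε) := by
  obtain ⟨ι, b, μ, hμ, hbμ, ⟨g, hg, hgμ⟩, -⟩ := exists_hilbertBasis_singular S hS hlam
  obtain ⟨τ, hτ, hmem⟩ := h
  have hs := (memℓp_ofReal_iff_summable hlam.2.1 hτ).1 hmem
  rcases hI with h1 | hI
  -- With the enlarged exponent `σ` the choice `Λ = 1` is admissible, and the factorial is not
  -- needed.
  · obtain ⟨σ, hσ, hsσ, hle⟩ := exists_tsum_rpow_le_one hlam.1 hlam.2.1 h1 hτ hs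
    refine stronglyPolynomiallyTractable_of_bounded S b hμ hbμ hσ
      (fun s => (sum_rpow_le_tsum_of_injective hμ hlam.2.1 g hg hgμ hσ hsσ s).trans hle) I
      (M := 1) fun d => ?_
    rw [one_pow]
    exact div_le_self zero_le_one (by exact_mod_cast Nat.factorial_pos _)
  · obtain ⟨M, hM⟩ := exists_pow_div_factorial_le hI (∑' m, lam m ^ τ)
      (tsum_nonneg fun m => Real.rpow_nonneg (hlam.2.1 m) _)
    exact stronglyPolynomiallyTractable_of_bounded S b hμ hbμ hτ
      (sum_rpow_le_tsum_of_injective hμ hlam.2.1 g hg hgμ hτ hs) I hM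

theorem tractability_tfae (S : H →L[ℝ] G) (hS : IsCompactOperator S)
    {lam : ℕ → ℝ} (hlam : IsEigenvalueSequence ((ContinuousLinearMap.adjoint S).comp S) lam)
    (I : ∀ d : ℕ, Finset (Fin d)) (hI : lam 0 < 1 ∨ CardGrowsLinearly I) :
    List.TFAE
        [StronglyPolynomiallyTractable (fun ε d => infoComplexity (antisymProblem S (I d)) ε),
         PolynomiallyTractable (fun ε d => infoComplexity (antisymProblem S (I d)) ε),
         ∃ τ : ℝ, 0 < τ ∧ Memℓp lam (ENNReal.ofReal τ)] := by
  tfae_have 1 → 2 := fun ⟨C, p, hC, hp, h⟩ => ⟨C, p, 0, hC, hp, le_rfl, h⟩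
  tfae_have 2 → 3 := exists_memℓp_of_polynomiallyTractable S hS hlam I
  tfae_have 3 → 1 := stronglyPolynomiallyTractable_of_memℓp S hS hlam I hI
  tfae_finish

end Equivalence

theorem mainTheorem4
    {H G : Type*}
    [NormedAddCommGroup H] [InnerProductSpace ℝ H] [CompleteSpace H]
    [NormedAddCommGroup G] [InnerProductSpace ℝ G] [CompleteSpace G]
    (S : H →L[ℝ] G) (hS : IsCompactOperator S)
    (lam : ℕ → ℝ)
    (hlam : IsEigenvalueSequence ((ContinuousLinearMap.adjoint S).comp S) lam)
    (I : ∀ d : ℕ, Finset (Fin d)) (hI : ∀ d : ℕ, 1 < d → (I d).Nonempty) :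
    (lam 0 < 1 →
      List.TFAE
        [StronglyPolynomiallyTractable (fun ε d => infoComplexity (antisymProblem S (I d)) ε),
         PolynomiallyTractable (fun ε d => infoComplexity (antisymProblem S (I d)) ε),
         ∃ τ : ℝ, 0 < τ ∧ Memℓp lam (ENNReal.ofReal τ)]) ∧
    (1 ≤ lam 0 → CardGrowsLinearly I →
      List.TFAE
        [StronglyPolynomiallyTractable (fun ε d => infoComplexity (antisymProblem S (I d)) ε),
         PolynomiallyTractable (fun ε d => infoComplexity (antisymProblem S (I d)) ε),
         ∃ τ : ℝ, 0 < τ ∧ Memℓp lam (ENNReal.ofReal τ)]) := by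
  exact ⟨fun h => tractability_tfae S hS hlam I (Or.inl h),
    fun _ h => tractability_tfae S hS hlam I (Or.inr h)⟩
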